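/- **Setting.** All algebras and Hilbert spaces are complex and finite-dimensional. A (finite-dimensional) spectral triple $(\mathcal A,\mathcal H,D)$ consists of a unital $*$-algebra $\mathcal A$ faithfully and unitally $*$-represented on a Hilbert space $\mathcal H$ (we omit the representation) and a self-adjoint operator $D$ on $\mathcal H$. Put $\mathrm d_Da=[D,a]$ and let $\Omega^1_D(\mathcal A)\subset\mathcal B(\mathcal H)$ be the $\mathcal A$-bimodule spanned by the operators $a[D,b]$, $a,b\in\mathcal A$. A connection on a right $\mathcal A$-module $\mathcal E$ is a linear map $\nabla:\mathcal E\to\mathcal E\otimes_{\mathcal A}\Omega^1_D(\mathcal A)$ with $\nabla(\eta a)=(\nabla\eta)a+\eta\otimes\mathrm d_Da$; it defines an operator on $\mathcal E\otimes_{\mathcal A}\mathcal H$ by $(1\otimes_\nabla D)(\eta\otimes\psi)=\eta\otimes D\psi+(\nabla\eta)\psi$. **Correspondences.** An $\mathcal A'$-$\mathcal A$ Morita equivalence bimodule is an $\mathcal A'$-$\mathcal A$-bimodule $\mathcal E$ with a positive definite $\mathcal A$-valued right Hermitian structure $(\cdot,\cdot)_{\mathcal A}$ and a positive definite $\mathcal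 A'$-valued left Hermitian structure $(\cdot,\cdot)_{\mathcal A'}$, both full (their values span $\mathcal A$, resp. $\mathcal A'$), such that $\eta(\xi,\zeta)_{\mathcal A}=(\eta,\xi)_{\mathcal A'}\zeta$, $(\eta a,\eta a)_{\mathcal A'}\le\|a\|^2(\eta,\eta)_{\mathcal A'}$ and $(b\eta,b\eta)_{\mathcal A}\le\|b\|^2(\eta,\eta)_{\mathcal A}$. Then $\mathcal A'\simeq\mathrm{End}_{\mathcal A}(\mathcal E)$ through the left action. A correspondence $(\mathcal E,\nabla,U):(\mathcal A,\mathcal H,D)\to(\mathcal A',\mathcal H',D')$ is an $\mathcal A'$-$\mathcal A$ Morita equivalence bimodule $\mathcal E$, a connection $\nabla$ on it, and a unitary $U:\mathcal E\otimes_{\mathcal A}\mathcal H\to\mathcal H'$, for the inner product $\langle\eta_1\otimes\psi_1,\eta_2\otimes\psi_2\rangle=\langle\psi_1,(\eta_1,\eta_2)_{\mathcal A}\psi_2\rangle$, that is $\mathcal A'$-linear (so that $\mathrm{Ad}_U$ identifies $\mathrm{End}_{\mathcal A}(\mathcal E)$ with $\mathcal A'$) and satisfies $U(1\otimes_\nabla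 D)=D'U$. Two correspondences $(\mathcal E,\nabla,U)$, $(\widetilde{\mathcal E},\widetilde\nabla,\widetilde U)$ with the same source and target are similar if there is a unitary (that is, bijective and preserving the $\mathcal A$-valued Hermitian structures) right $\mathcal A$-linear map $V:\mathcal E\to\widetilde{\mathcal E}$ with $\widetilde U(V\otimes\mathrm{id}_{\mathcal H})=U$. This is an equivalence relation; its classes are called M-morphisms. **Identity and composition.** The identity correspondence of $(\mathcal A,\mathcal H,D)$ is $(\mathcal A,\nabla_D,m)$, where $\mathcal A$ carries the Hermitian structures $a^*b$ (right) and $ab^*$ (left), $\nabla_D(a)=1\otimes[D,a]$ and $m(a\otimes\psi)=a\psi$. The composition of $(\mathcal E,\nabla,U):(\mathcal A,\mathcal H,D)\to(\mathcal A',\mathcal H',D')$ and $(\mathcal E',\nabla',U'):(\mathcal A',\mathcal H',D')\to(\mathcal A'',\mathcal H'',D'')$ is $(\mathcal E'',\nabla'',U'')$, where $\mathcal E''=\mathcal E'\otimes_{\mathcal A'}\mathcal E$ with $$(\eta_1'\otimes\eta_1,\eta_2'\otimes\eta_2)_{\mathcal A}=(\eta_1,(\eta_1',\eta_2')_{\mathcal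 A'}\,\eta_2)_{\mathcal A},\qquad (\eta_1'\otimes\eta_1,\eta_2'\otimes\eta_2)_{\mathcal A''}=(\eta_1'\,(\eta_1,\eta_2)_{\mathcal A'},\eta_2')_{\mathcal A''},$$ $$\nabla''(\eta'\otimes\eta)=(\mathrm{id}_{\mathcal E'}\otimes\sigma)(\nabla'\eta'\otimes\eta)+\eta'\otimes\nabla\eta,\qquad U''(\eta'\otimes\eta\otimes\psi)=U'(\eta'\otimes U(\eta\otimes\psi)),$$ and $\sigma:\Omega^1_{D'}(\mathcal A')\otimes_{\mathcal A'}\mathcal E\to\mathcal E\otimes_{\mathcal A}\Omega^1_D(\mathcal A)$ is the bimodule map $\sigma(a'[D',b']\otimes\eta)=a'\nabla(b'\eta)-a'b'\nabla(\eta)$. (Identity and composition are understood up to isomorphisms of bimodules that respect all the structure.) **Theorem.** For every finite-dimensional spectral triple the identity correspondence is a correspondence, and the composition of two correspondences (with the map $\sigma$) is well defined and is a correspondence. Both descend to M-morphisms: the class of the composition depends only on the classes of the factors. The composition of M-morphisms is associative, and finite-dimensional spectral triples with M-morphisms, this composition and the classes of the identity correspondences form a category (the "Morita category"). -/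

import Mathlib

open scoped TensorProduct InnerProductSpace
open MulOpposite

universe u

noncomputable section

/-! ### Tensor product over a noncommutative algebra -/

section BalancedTensor

variable (A : Type*) [Ring A]
variable (M : Type*) [AddCommGroup M] [Module ℂ M] [Module Aᵐᵒᵖ M]
variable (N : Type*) [AddCommGroup N] [Module ℂ N] [Module A N]

/-- The subspace of `M ⊗[ℂ] N` spanned by the elements `m a ⊗ n - m ⊗ a n`. -/
def balancedRelations : Submodule ℂ (M ⊗[ℂ] N) :=
  Submodule.span ℂ {x | ∃ (m : M) (a : A) (n : N), x = (op a • m) ⊗ₜ[ℂ] n - m ⊗ₜ[ℂ] (a • n)}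

/-- `M ⊗_A N` for a right `A`-module `M` (that is, a module over `Aᵐᵒᵖ`) and a left `A`-module
`N`, where `A` need not be commutative. -/
abbrev BTensor : Type _ := (M ⊗[ℂ] N) ⧸ balancedRelations A M N

namespace BTensor

variable {M N}

/-- The elementary tensor `m ⊗ n` in `M ⊗_A N`. -/
def mk (m : M) (n : N) : BTensor A M N := (balancedRelations A M N).mkQ (m ⊗ₜ[ℂ] n)

theorem mk_smul (m : M) (a : A) (n : N) : mk A (op a • m) n = mk A m (a • n) := by
  refine (Submodule.Quotient.eq _).2 (Submodule.subset_span ⟨m, a, n, rfl⟩)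

theorem mk_add (m : M) (n n' : N) : mk A m (n + n') = mk A m n + mk A m n' := by
  simp [mk, TensorProduct.tmul_add]

theorem mk_smul_right (z : ℂ) (m : M) (n : N) : mk A m (z • n) = z • mk A m n := by
  simp [mk, TensorProduct.tmul_smul]

/-- The linear map `m ⊗ n ↦ f m n` defined on `M ⊗_A N` by a balanced bilinear map `f`. -/
def lift {P : Type*} [AddCommGroup P] [Module ℂ P] (f : M →ₗ[ℂ] N →ₗ[ℂ] P)
    (hf : ∀ (m : M) (a : A) (n : N), f (op a • m) n = f m (a • n)) : BTensor A M N →ₗ[ℂ] P :=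
  (balancedRelations A M N).liftQ (TensorProduct.lift f) (by
    refine Submodule.span_le.2 ?_
    rintro _ ⟨m, a, n, rfl⟩
    simp [hf])

@[simp] theorem lift_mk {P : Type*} [AddCommGroup P] [Module ℂ P] (f : M →ₗ[ℂ] N →ₗ[ℂ] P)
    (hf : ∀ (m : M) (a : A) (n : N), f (op a • m) n = f m (a • n)) (m : M) (n : N) :
    lift A f hf (mk A m n) = f m n :=
  TensorProduct.lift.tmul m n

theorem hom_ext {P : Type*} [AddCommGroup P] [Module ℂ P] {f g : BTensor A M N →ₗ[ℂ] P}
    (h : ∀ m n, f (mk A m n) = g (mk A m n)) : f = g := by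
  refine Submodule.linearMap_qext _ (TensorProduct.ext' fun m n => h m n)

variable {A}
variable [Algebra ℂ A] [IsScalarTower ℂ Aᵐᵒᵖ M] [IsScalarTower ℂ A N]
variable {M' : Type*} [AddCommGroup M'] [Module ℂ M'] [Module Aᵐᵒᵖ M'] [IsScalarTower ℂ Aᵐᵒᵖ M']
variable {N' : Type*} [AddCommGroup N'] [Module ℂ N'] [Module A N'] [IsScalarTower ℂ A N']

/-- The map `f ⊗ g : M ⊗_A N → M' ⊗_A N'` for `A`-linear maps `f` and `g`. -/
def map (f : M →ₗ[Aᵐᵒᵖ] M') (g : N →ₗ[A] N') : BTensor A M N →ₗ[ℂ] BTensor A M' N' :=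
  lift A (((TensorProduct.mk ℂ M' N').compr₂ (balancedRelations A M' N').mkQ).compl₁₂
    (f.restrictScalars ℂ) (g.restrictScalars ℂ)) (by
      intro m a n
      have := mk_smul A (f m) a (g n)
      simpa [mk] using this)

@[simp] theorem map_mk (f : M →ₗ[Aᵐᵒᵖ] M') (g : N →ₗ[A] N') (m : M) (n : N) :
    map f g (mk A m n) = mk A (f m) (g n) :=
  lift_mk A _ _ m n

end BTensor

end BalancedTensor

/-! ### Finite-dimensional spectral triples -/

/-- A finite-dimensional spectral triple `(A, H, D)`: a unital complex `*`-algebra `A` with a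
faithful unital `*`-representation `π` on a finite-dimensional complex Hilbert space `H`,
and a self-adjoint operator `D` on `H`. -/
structure FinSpectralTriple : Type (u + 1) where
  A : Type u
  [ringA : Ring A]
  [starRingA : StarRing A]
  [algebraA : Algebra ℂ A]
  [starModuleA : StarModule ℂ A]
  [finiteA : FiniteDimensional ℂ A]
  H : Type u
  [normedH : NormedAddCommGroup H]
  [innerH : InnerProductSpace ℂ H]
  [completeH : CompleteSpace H]
  [finiteH : FiniteDimensional ℂ H]
  π : A →⋆ₐ[ℂ] (H →L[ℂ] H)
  π_injective : Function.Injective π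
  D : H →L[ℂ] H
  D_selfAdjoint : IsSelfAdjoint D

namespace FinSpectralTriple

attribute [instance] ringA starRingA algebraA starModuleA finiteA normedH innerH completeH finiteH

variable (X : FinSpectralTriple.{u})

/-- The action of `A` on `H` through the representation. -/
instance moduleH : Module X.A X.H where
  smul a ψ := X.π a ψ
  one_smul ψ := by change X.π 1 ψ = ψ; simp
  mul_smul a b ψ := by change X.π (a * b) ψ = X.π a (X.π b ψ); simp
  smul_zero a := by change X.π a 0 = 0; simp
  smul_add a ψ φ := by change X.π a (ψ + φ) = X.π a ψ + X.π a φ; simp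
  add_smul a b ψ := by change X.π (a + b) ψ = X.π a ψ + X.π b ψ; simp
  zero_smul ψ := by change X.π 0 ψ = 0; simp

theorem smul_def (a : X.A) (ψ : X.H) : a • ψ = X.π a ψ := rfl

instance scalarTowerH : IsScalarTower ℂ X.A X.H where
  smul_assoc z a ψ := by simp [smul_def]

/-- The differential `d_D b = [D, b]`, an operator on `H`. -/
def commD (b : X.A) : X.H →L[ℂ] X.H := X.D * X.π b - X.π b * X.D

/-- The space of one-forms `Ω¹_D(A)`: the span of the operators `a [D, b]`. -/
def Omega : Submodule ℂ (X.H →L[ℂ] X.H) :=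
  Submodule.span ℂ {ω | ∃ a b : X.A, ω = X.π a * X.commD b}

/-- The one-form `a [D, b]`. -/
def form (a b : X.A) : X.Omega := ⟨X.π a * X.commD b, Submodule.subset_span ⟨a, b, rfl⟩⟩

/-- The one-form `d_D b = [D, b]`. -/
def d (b : X.A) : X.Omega := X.form 1 b

theorem mul_left_mem (a : X.A) {ω : X.H →L[ℂ] X.H} (hω : ω ∈ X.Omega) :
    X.π a * ω ∈ X.Omega := by
  have h : X.Omega ≤ X.Omega.comap (LinearMap.mulLeft ℂ (X.π a)) := by
    refine Submodule.span_le.2 ?_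
    rintro _ ⟨b, c, rfl⟩
    refine Submodule.subset_span ⟨a * b, c, ?_⟩
    simp [mul_assoc]
  exact h hω

theorem mul_right_mem (a : X.A) {ω : X.H →L[ℂ] X.H} (hω : ω ∈ X.Omega) :
    ω * X.π a ∈ X.Omega := by
  have h : X.Omega ≤ X.Omega.comap (LinearMap.mulRight ℂ (X.π a)) := by
    refine Submodule.span_le.2 ?_
    rintro _ ⟨b, c, rfl⟩
    have h1 : X.π b * X.commD (c * a) ∈ X.Omega := Submodule.subset_span ⟨b, c * a, rfl⟩
    have h2 : X.π (b * c) * X.commD a ∈ X.Omega := Submodule.subset_span ⟨b * c, a, rfl⟩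
    have h3 := X.Omega.sub_mem h1 h2
    have e : X.π b * X.commD (c * a) - X.π (b * c) * X.commD a
        = X.π b * X.commD c * X.π a := by
      simp only [commD, map_mul]
      noncomm_ring
    rw [e] at h3
    exact h3
  exact h hω

/-- The left `A`-module structure `(a, ω) ↦ a ω` of `Ω¹_D(A)`. -/
instance moduleOmega : Module X.A X.Omega where
  smul a ω := ⟨X.π a * ω.1, X.mul_left_mem a ω.2⟩
  one_smul ω := Subtype.ext (by change X.π 1 * ω.1 = ω.1; simp)
  mul_smul a b ω := Subtype.ext (by
    change X.π (a * b) * ω.1 = X.π a * (X.π b * ω.1); simp [mul_assoc])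
  smul_zero a := Subtype.ext (by change X.π a * 0 = 0; simp)
  smul_add a ω ω' := Subtype.ext (by
    change X.π a * (ω.1 + ω'.1) = X.π a * ω.1 + X.π a * ω'.1; simp [mul_add])
  add_smul a b ω := Subtype.ext (by
    change X.π (a + b) * ω.1 = X.π a * ω.1 + X.π b * ω.1; simp [add_mul])
  zero_smul ω := Subtype.ext (by change X.π 0 * ω.1 = 0; simp)

/-- The right `A`-module structure `(ω, a) ↦ ω a` of `Ω¹_D(A)`. -/
instance moduleOpOmega : Module X.Aᵐᵒᵖ X.Omega where
  smul a ω := ⟨ω.1 * X.π a.unop, X.mul_right_mem a.unop ω.2⟩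
  one_smul ω := Subtype.ext (by change ω.1 * X.π 1 = ω.1; simp)
  mul_smul a b ω := Subtype.ext (by
    change ω.1 * X.π (b.unop * a.unop) = (ω.1 * X.π b.unop) * X.π a.unop; simp [mul_assoc])
  smul_zero a := Subtype.ext (by change 0 * X.π a.unop = 0; simp)
  smul_add a ω ω' := Subtype.ext (by
    change (ω.1 + ω'.1) * X.π a.unop = ω.1 * X.π a.unop + ω'.1 * X.π a.unop; simp [add_mul])
  add_smul a b ω := Subtype.ext (by
    change ω.1 * X.π (a.unop + b.unop) = ω.1 * X.π a.unop + ω.1 * X.π b.unop; simp [mul_add])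
  zero_smul ω := Subtype.ext (by change ω.1 * X.π 0 = 0; simp)

theorem coe_smul_omega (a : X.A) (ω : X.Omega) :
    ((a • ω : X.Omega) : X.H →L[ℂ] X.H) = X.π a * ω.1 := rfl

theorem coe_op_smul_omega (a : X.A) (ω : X.Omega) :
    ((op a • ω : X.Omega) : X.H →L[ℂ] X.H) = ω.1 * X.π a := rfl

instance scalarTowerOmega : IsScalarTower ℂ X.A X.Omega where
  smul_assoc z a ω := Subtype.ext (by
    change X.π (z • a) * ω.1 = z • (X.π a * ω.1); simp)

instance smulCommOmega : SMulCommClass X.Aᵐᵒᵖ X.A X.Omega where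
  smul_comm a b ω := Subtype.ext (by
    change (X.π b * ω.1) * X.π a.unop = X.π b * (ω.1 * X.π a.unop); simp [mul_assoc])

end FinSpectralTriple

/-! ### Connections and fluctuations -/

section Connections

variable {X : FinSpectralTriple.{u}}
variable {E : Type u} [AddCommGroup E] [Module ℂ E] [Module X.Aᵐᵒᵖ E] [IsScalarTower ℂ X.Aᵐᵒᵖ E]

/-- Right multiplication by `a` on `E ⊗_A Ω¹_D(A)`. -/
def rmul (a : X.A) : BTensor X.A E X.Omega →ₗ[ℂ] BTensor X.A E X.Omega :=
  BTensor.map LinearMap.id (DistribSMul.toLinearMap X.A X.Omega (op a))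

/-- For `ψ` in `H`, the map `E ⊗_A Ω¹_D(A) → E ⊗_A H`, `x ↦ x ψ`, where
`(η ⊗ ω) ψ = η ⊗ ω(ψ)`. -/
def applyForm (ψ : X.H) : BTensor X.A E X.Omega →ₗ[ℂ] BTensor X.A E X.H :=
  BTensor.map LinearMap.id
    { toFun := fun ω => ω.1 ψ
      map_add' := fun _ _ => rfl
      map_smul' := fun _ _ => rfl }

variable (X E) in
/-- A connection `∇ : E → E ⊗_A Ω¹_D(A)` on the right `A`-module `E`. -/
structure Connection where
  toFun : E →ₗ[ℂ] BTensor X.A E X.Omega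
  leibniz : ∀ (η : E) (a : X.A),
    toFun (op a • η) = rmul a (toFun η) + BTensor.mk X.A η (X.d a)

@[simp] theorem applyForm_mk (ψ : X.H) (η : E) (ω : X.Omega) :
    applyForm ψ (BTensor.mk X.A η ω) = BTensor.mk X.A η (ω.1 ψ) :=
  BTensor.map_mk _ _ _ _

theorem applyForm_add (ψ φ : X.H) (x : BTensor X.A E X.Omega) :
    applyForm (ψ + φ) x = applyForm ψ x + applyForm φ x := by
  have h : applyForm (E := E) (ψ + φ) = applyForm ψ + applyForm φ :=
    BTensor.hom_ext X.A fun m n => by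
      simp [LinearMap.add_apply, BTensor.mk_add]
  rw [h]; rfl

theorem applyForm_smul (z : ℂ) (ψ : X.H) (x : BTensor X.A E X.Omega) :
    applyForm (z • ψ) x = z • applyForm ψ x := by
  have h : applyForm (E := E) (z • ψ) = z • applyForm ψ :=
    BTensor.hom_ext X.A fun m n => by
      simp [LinearMap.smul_apply, BTensor.mk_smul_right]
  rw [h]; rfl

theorem applyForm_rmul (a : X.A) (ψ : X.H) (x : BTensor X.A E X.Omega) :
    applyForm ψ (rmul a x) = applyForm (a • ψ) x := by
  have h : applyForm (E := E) ψ ∘ₗ rmul a = applyForm (a • ψ) :=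
    BTensor.hom_ext X.A fun m n => by
      simp [rmul, FinSpectralTriple.smul_def, FinSpectralTriple.coe_op_smul_omega]
  rw [← h]; rfl

/-- The fluctuated Dirac operator `1 ⊗_∇ D` on `E ⊗_A H`:
`(1 ⊗_∇ D)(η ⊗ ψ) = η ⊗ D ψ + (∇ η) ψ`. -/
def fluctuatedDirac (nabla : Connection X E) : BTensor X.A E X.H →ₗ[ℂ] BTensor X.A E X.H :=
  BTensor.lift X.A
    (LinearMap.mk₂ ℂ (fun η ψ => BTensor.mk X.A η (X.D ψ) + applyForm ψ (nabla.toFun η))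
      (fun η η' ψ => by simp [BTensor.mk, TensorProduct.add_tmul]; abel)
      (fun z η ψ => by simp [BTensor.mk, ← TensorProduct.smul_tmul'])
      (fun η ψ ψ' => by simp [BTensor.mk, TensorProduct.tmul_add, applyForm_add]; abel)
      (fun z η ψ => by simp [BTensor.mk, TensorProduct.tmul_smul, applyForm_smul]))
    (fun η a ψ => by
      simp only [LinearMap.mk₂_apply, nabla.leibniz, map_add, applyForm_rmul, applyForm_mk,
        BTensor.mk_smul]
      have h : X.D (a • ψ) = a • X.D ψ + (X.d a).1 ψ := by
        simp [FinSpectralTriple.d, FinSpectralTriple.form, FinSpectralTriple.commD,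
          FinSpectralTriple.smul_def]
      rw [h]
      simp only [BTensor.mk, TensorProduct.tmul_add, map_add]
      abel)

end Connections

/-! ### Morita equivalence bimodules -/

/-- An `A'`-`A` Morita equivalence bimodule, for the algebras `A` of `X` and `A'` of `Y`, with its
`A`-valued (right) and `A'`-valued (left) Hermitian structures. The order and the norm on the
algebras are those of operators on the Hilbert spaces. As the algebras are finite-dimensional,
fullness means that the values of the Hermitian structures span; it makes `E` finitely generated,
so that `E` is finite-dimensional and complete. -/
structure MoritaBimodule (X Y : FinSpectralTriple.{u}) : Type (u + 1) where
  E : Type u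
  [addCommGroupE : AddCommGroup E]
  [moduleE : Module ℂ E]
  [leftE : Module Y.A E]
  [rightE : Module X.Aᵐᵒᵖ E]
  [scalarTowerLeft : IsScalarTower ℂ Y.A E]
  [scalarTowerRight : IsScalarTower ℂ X.Aᵐᵒᵖ E]
  [smulComm : SMulCommClass Y.A X.Aᵐᵒᵖ E]
  /-- the right Hermitian structure, conjugate linear in the first argument -/
  innerR : E →ₗ⋆[ℂ] E →ₗ[ℂ] X.A
  /-- the left Hermitian structure, conjugate linear in the second argument -/
  innerL : E →ₗ[ℂ] E →ₗ⋆[ℂ] Y.A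
  innerR_smul : ∀ (η ξ : E) (a b : X.A),
    innerR (op a • η) (op b • ξ) = star a * innerR η ξ * b
  innerL_smul : ∀ (η ξ : E) (a b : Y.A),
    innerL (a • η) (b • ξ) = a * innerL η ξ * star b
  star_innerR : ∀ η ξ : E, star (innerR η ξ) = innerR ξ η
  star_innerL : ∀ η ξ : E, star (innerL η ξ) = innerL ξ η
  innerR_pos : ∀ η : E, η ≠ 0 → (X.π (innerR η η)).IsPositive ∧ innerR η η ≠ 0
  innerL_pos : ∀ η : E, η ≠ 0 → (Y.π (innerL η η)).IsPositive ∧ innerL η η ≠ 0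
  fullR : Submodule.span ℂ {a : X.A | ∃ η ξ : E, a = innerR η ξ} = ⊤
  fullL : Submodule.span ℂ {b : Y.A | ∃ η ξ : E, b = innerL η ξ} = ⊤
  compatible : ∀ η ξ ζ : E, op (innerR ξ ζ) • η = innerL η ξ • ζ
  bound_right : ∀ (a : X.A) (η : E),
    (Y.π (((‖X.π a‖ ^ 2 : ℝ) : ℂ) • innerL η η - innerL (op a • η) (op a • η))).IsPositive
  bound_left : ∀ (b : Y.A) (η : E),
    (X.π (((‖Y.π b‖ ^ 2 : ℝ) : ℂ) • innerR η η - innerR (b • η) (b • η))).IsPositive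

attribute [instance] MoritaBimodule.addCommGroupE MoritaBimodule.moduleE MoritaBimodule.leftE
  MoritaBimodule.rightE MoritaBimodule.scalarTowerLeft MoritaBimodule.scalarTowerRight
  MoritaBimodule.smulComm

/-- Left multiplication by `b` on `E ⊗_A Ω¹_D(A)`. -/
def MoritaBimodule.lmul {X Y : FinSpectralTriple.{u}} (M : MoritaBimodule X Y) (b : Y.A) :
    BTensor X.A M.E X.Omega →ₗ[ℂ] BTensor X.A M.E X.Omega :=
  BTensor.map (DistribSMul.toLinearMap X.Aᵐᵒᵖ M.E b) LinearMap.id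

/-! ### Correspondences and M-morphisms -/

/-- A correspondence `(E, ∇, U)` from `X = (A, H, D)` to `Y = (A', H', D')`: an `A'`-`A` Morita
equivalence bimodule `E`, a connection `∇` on `E`, and a unitary equivalence
`U : E ⊗_A H → H'` between the fluctuation `(End_A(E), E ⊗_A H, 1 ⊗_∇ D)` and `Y`. The inner
product of `E ⊗_A H` is `⟪η₁ ⊗ ψ₁, η₂ ⊗ ψ₂⟫ = ⟪ψ₁, (η₁, η₂) ψ₂⟫`. The left action of `A'` on `E`
is an isomorphism from `A'` onto `End_A(E)`, and `map_smul` says that `Ad_U` is its inverse. -/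
structure Correspondence (X Y : FinSpectralTriple.{u}) extends MoritaBimodule X Y where
  nabla : Connection X E
  U : BTensor X.A E X.H ≃ₗ[ℂ] Y.H
  inner_map : ∀ (η₁ η₂ : E) (ψ₁ ψ₂ : X.H),
    ⟪U (BTensor.mk X.A η₁ ψ₁), U (BTensor.mk X.A η₂ ψ₂)⟫_ℂ = ⟪ψ₁, X.π (innerR η₁ η₂) ψ₂⟫_ℂ
  map_smul : ∀ (b : Y.A) (η : E) (ψ : X.H),
    U (BTensor.mk X.A (b • η) ψ) = Y.π b (U (BTensor.mk X.A η ψ))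
  map_dirac : ∀ x : BTensor X.A E X.H, U (fluctuatedDirac nabla x) = Y.D (U x)

section Similarity

variable {X Y : FinSpectralTriple.{u}}

/-- Similarity: a unitary right `A`-linear map `V : E → E'` with `U' (V ⊗ id_H) = U`. -/
def CorrSimilar (c c' : Correspondence X Y) : Prop :=
  ∃ V : c.E ≃ₗ[X.Aᵐᵒᵖ] c'.E,
    (∀ η ξ : c.E, c'.innerR (V η) (V ξ) = c.innerR η ξ) ∧
    ∀ x : BTensor X.A c.E X.H, c'.U (BTensor.map V.toLinearMap LinearMap.id x) = c.U x

theorem similar_iff {c c' : Correspondence X Y} : CorrSimilar c c' ↔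
    ∃ V : c.E ≃ₗ[X.Aᵐᵒᵖ] c'.E,
      (∀ η ξ : c.E, c'.innerR (V η) (V ξ) = c.innerR η ξ) ∧
      ∀ (η : c.E) (ψ : X.H), c'.U (BTensor.mk X.A (V η) ψ) = c.U (BTensor.mk X.A η ψ) := by
  refine exists_congr fun V => and_congr_right fun _ => ⟨fun h η ψ => ?_, fun h x => ?_⟩
  · simpa using h (BTensor.mk X.A η ψ)
  · have e : c'.U.toLinearMap ∘ₗ BTensor.map V.toLinearMap LinearMap.id = c.U.toLinearMap :=
      BTensor.hom_ext X.A fun η ψ => by simpa using h η ψ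
    exact LinearMap.congr_fun e x

variable (X Y) in
/-- Similarity is an equivalence relation. -/
instance similarSetoid : Setoid (Correspondence X Y) where
  r := CorrSimilar
  iseqv :=
    { refl := fun c => similar_iff.2 ⟨LinearEquiv.refl _ _, fun _ _ => rfl, fun _ _ => rfl⟩
      symm := fun {c c'} h => by
        obtain ⟨V, h1, h2⟩ := similar_iff.1 h
        refine similar_iff.2 ⟨V.symm, fun η ξ => ?_, fun η ψ => ?_⟩
        · rw [← h1]; simp
        · rw [← h2]; simp
      trans := fun {c c' c''} h h' => by
        obtain ⟨V, h1, h2⟩ := similar_iff.1 h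
        obtain ⟨W, h3, h4⟩ := similar_iff.1 h'
        refine similar_iff.2 ⟨V.trans W, fun η ξ => ?_, fun η ψ => ?_⟩
        · rw [← h1, ← h3]; rfl
        · rw [← h2, ← h4]; rfl }

variable (X Y) in
/-- An M-morphism is a similarity class of correspondences. -/
def MMorphism : Type (u + 1) := Quotient (similarSetoid X Y)

/-- The M-morphism represented by a correspondence. -/
def Correspondence.toMMorphism (c : Correspondence X Y) : MMorphism X Y :=
  Quotient.mk (similarSetoid X Y) c

end Similarity

/-! ### The identity correspondence -/

/-- `c` is the correspondence `(A, ∇_D, m)` from `(A, H, D)` to itself, up to an isomorphism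
`e : A ≃ E` that respects all the structure: `E = A` with `(a, b) ↦ a* b` and `(a, b) ↦ a b*` as
Hermitian structures, `∇_D a = 1 ⊗ [D, a]`, and `m (a ⊗ ψ) = a ψ`. -/
def IsIdentity {X : FinSpectralTriple.{u}} (c : Correspondence X X) : Prop :=
  ∃ e : X.A ≃ₗ[ℂ] c.E,
    (∀ a b : X.A, e (a * b) = a • e b) ∧
    (∀ a b : X.A, e (a * b) = op b • e a) ∧
    (∀ a b : X.A, c.innerR (e a) (e b) = star a * b) ∧
    (∀ a b : X.A, c.innerL (e a) (e b) = a * star b) ∧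
    (∀ a : X.A, c.nabla.toFun (e a) = BTensor.mk X.A (e 1) (X.d a)) ∧
    ∀ (a : X.A) (ψ : X.H), c.U (BTensor.mk X.A (e a) ψ) = X.π a ψ

/-! ### Composition of correspondences -/

section Composition

variable {X Y Z : FinSpectralTriple.{u}}

/-- An isomorphism of `A''`-`A` Hermitian bimodules from `E' ⊗_{A'} E` onto `E''`, where the
Hermitian structures of the tensor product are
`(η₁' ⊗ η₁, η₂' ⊗ η₂)_A = (η₁, (η₁', η₂')_{A'} η₂)_A` and
`(η₁' ⊗ η₁, η₂' ⊗ η₂)_{A''} = (η₁' (η₁, η₂)_{A'}, η₂')_{A''}`. -/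
structure TensorIso (M : MoritaBimodule X Y) (M' : MoritaBimodule Y Z)
    (M'' : MoritaBimodule X Z) where
  t : BTensor Y.A M'.E M.E ≃ₗ[ℂ] M''.E
  map_left : ∀ (b : Z.A) (η' : M'.E) (η : M.E),
    t (BTensor.mk Y.A (b • η') η) = b • t (BTensor.mk Y.A η' η)
  map_right : ∀ (a : X.A) (η' : M'.E) (η : M.E),
    t (BTensor.mk Y.A η' (op a • η)) = op a • t (BTensor.mk Y.A η' η)
  map_innerR : ∀ (η₁' η₂' : M'.E) (η₁ η₂ : M.E),
    M''.innerR (t (BTensor.mk Y.A η₁' η₁)) (t (BTensor.mk Y.A η₂' η₂))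
      = M.innerR η₁ (M'.innerR η₁' η₂' • η₂)
  map_innerL : ∀ (η₁' η₂' : M'.E) (η₁ η₂ : M.E),
    M''.innerL (t (BTensor.mk Y.A η₁' η₁)) (t (BTensor.mk Y.A η₂' η₂))
      = M'.innerL (op (M.innerL η₁ η₂) • η₁') η₂'

/-- For `η'` in `E'`, the right `A`-linear map `E → E''`, `η ↦ η' ⊗ η`. -/
def TensorIso.insert {M : MoritaBimodule X Y} {M' : MoritaBimodule Y Z} {M'' : MoritaBimodule X Z}
    (T : TensorIso M M' M'') (η' : M'.E) : M.E →ₗ[X.Aᵐᵒᵖ] M''.E where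
  toFun η := T.t (BTensor.mk Y.A η' η)
  map_add' η ξ := by simp [BTensor.mk, TensorProduct.tmul_add]
  map_smul' a η := T.map_right a.unop η' η

/-- For `η'` in `E'`, the map `E ⊗_A Ω¹_D(A) → E'' ⊗_A Ω¹_D(A)`, `x ↦ η' ⊗ x`. -/
def TensorIso.insertForm {M : MoritaBimodule X Y} {M' : MoritaBimodule Y Z}
    {M'' : MoritaBimodule X Z} (T : TensorIso M M' M'') (η' : M'.E) :
    BTensor X.A M.E X.Omega →ₗ[ℂ] BTensor X.A M''.E X.Omega :=
  BTensor.map (T.insert η') LinearMap.id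

/-- `σ : Ω¹_{D'}(A') ⊗_{A'} E → E ⊗_A Ω¹_D(A)` is the bimodule map
`σ (a' [D', b'] ⊗ η) = a' ∇ (b' η) - a' b' ∇ η`. Here `Ω¹_{D'}(A')` is identified by `Ad_{U*}` with
the one-forms of the fluctuation of `X` in the direction of `(E, ∇)`, as `A'` is with `End_A(E)`. -/
structure IsSigma (c : Correspondence X Y)
    (σ : BTensor Y.A Y.Omega c.E →ₗ[ℂ] BTensor X.A c.E X.Omega) : Prop where
  apply_form : ∀ (a b : Y.A) (η : c.E), σ (BTensor.mk Y.A (Y.form a b) η)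
    = c.lmul a (c.nabla.toFun (b • η)) - c.lmul (a * b) (c.nabla.toFun η)
  map_left : ∀ (a : Y.A) (ω : Y.Omega) (η : c.E),
    σ (BTensor.mk Y.A (a • ω) η) = c.lmul a (σ (BTensor.mk Y.A ω η))
  map_right : ∀ (a : X.A) (ω : Y.Omega) (η : c.E),
    σ (BTensor.mk Y.A ω (op a • η)) = rmul a (σ (BTensor.mk Y.A ω η))

/-- `c''` is the composition of `c = (E, ∇, U)` with `c' = (E', ∇', U')`, up to an isomorphism of
bimodules `T : E' ⊗_{A'} E ≃ E''`. The maps `S η` are `x ↦ (id ⊗ σ)(x ⊗ η)`; the connection is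
`∇'' (η' ⊗ η) = (id ⊗ σ)(∇' η' ⊗ η) + η' ⊗ ∇ η`, and the unitary is `U'' = U' (id ⊗ U)`. -/
def IsComposition (c : Correspondence X Y) (c' : Correspondence Y Z) (c'' : Correspondence X Z) :
    Prop :=
  ∃ T : TensorIso c.toMoritaBimodule c'.toMoritaBimodule c''.toMoritaBimodule,
    (∃ σ : BTensor Y.A Y.Omega c.E →ₗ[ℂ] BTensor X.A c.E X.Omega, IsSigma c σ ∧
      ∃ S : c.E → (BTensor Y.A c'.E Y.Omega →ₗ[ℂ] BTensor X.A c''.E X.Omega),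
        (∀ (η : c.E) (η' : c'.E) (ω : Y.Omega),
          S η (BTensor.mk Y.A η' ω) = T.insertForm η' (σ (BTensor.mk Y.A ω η))) ∧
        ∀ (η' : c'.E) (η : c.E), c''.nabla.toFun (T.t (BTensor.mk Y.A η' η))
          = S η (c'.nabla.toFun η') + T.insertForm η' (c.nabla.toFun η)) ∧
    ∀ (η' : c'.E) (η : c.E) (ψ : X.H),
      c''.U (BTensor.mk X.A (T.t (BTensor.mk Y.A η' η)) ψ)
        = c'.U (BTensor.mk Y.A η' (c.U (BTensor.mk X.A η ψ)))

end Composition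

end

/-! A correspondence `(E, ∇, U)` is, up to similarity, a subspace of operators. Send `η` to the
operator `U(η ⊗ ·) : H → H'` (`toOp`). This map is injective, turns the module actions into
composition with represented elements, and turns the Hermitian structures into `x* y` and `x y*`.
The relation `U(1 ⊗_∇ D) = D'U` says that `∇η` corresponds to `D'x - xD`, where `x` is the operator
of `η`. Since `E ⊗_A Ω¹` also embeds into operators, `∇` is determined by `E`, `U` and the Dirac
operators.

The range `B` satisfies `A'B ⊆ B`, `BA ⊆ B`, `B*B = A`, `BB* = A'` and `D'x - xD ∈ BΩ¹` for `x ∈ B`;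
this is an `OpBimodule`. Conversely, every such `B` is realized (`exists_correspondence`): `U` is
evaluation and `∇` lifts `x ↦ D'x - xD`.

In this picture similarity is equality of ranges (`similar_iff_carrier_eq`), the identity is the
range `A` (`isIdentity_iff_carrier_eq`), and composition is the span of products `B'B`
(`isComposition_iff_carrier_eq`). The category axioms become associativity of products of subspaces
and `A'B = B = BA`. That `B'B` is again an operator bimodule rests on the Leibniz rule and on
`Ω¹_{D'} B ⊆ B Ω¹_D` (`omega_mul_le`), which is also what makes `σ` well defined. -/

noncomputable section

/-! ### Subspaces of operators -/

section OperatorSpaces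

variable {U V W T : Type*} [NormedAddCommGroup U] [InnerProductSpace ℂ U]
  [NormedAddCommGroup V] [InnerProductSpace ℂ V]
  [NormedAddCommGroup W] [InnerProductSpace ℂ W]
  [NormedAddCommGroup T] [InnerProductSpace ℂ T]

/-- Composition of operators as a bilinear map. -/
def compBilin (U V W : Type*) [NormedAddCommGroup U] [InnerProductSpace ℂ U]
    [NormedAddCommGroup V] [InnerProductSpace ℂ V] [NormedAddCommGroup W] [InnerProductSpace ℂ W] :
    (V →L[ℂ] W) →ₗ[ℂ] (U →L[ℂ] V) →ₗ[ℂ] (U →L[ℂ] W) :=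
  LinearMap.mk₂ ℂ (fun x y => x ∘L y) (fun _ _ _ => ContinuousLinearMap.add_comp _ _ _)
    (fun _ _ _ => ContinuousLinearMap.smul_comp _ _ _)
    (fun _ _ _ => ContinuousLinearMap.comp_add _ _ _)
    (fun _ _ _ => ContinuousLinearMap.comp_smul _ _ _)

@[simp] theorem compBilin_apply (x : V →L[ℂ] W) (y : U →L[ℂ] V) :
    compBilin U V W x y = x ∘L y := rfl

/-- The span of the products of the operators in two subspaces. -/
def opMul (P : Submodule ℂ (V →L[ℂ] W)) (Q : Submodule ℂ (U →L[ℂ] V)) :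
    Submodule ℂ (U →L[ℂ] W) :=
  Submodule.map₂ (compBilin U V W) P Q

theorem comp_mem_opMul {P : Submodule ℂ (V →L[ℂ] W)} {Q : Submodule ℂ (U →L[ℂ] V)}
    {x : V →L[ℂ] W} {y : U →L[ℂ] V} (hx : x ∈ P) (hy : y ∈ Q) : x ∘L y ∈ opMul P Q :=
  Submodule.apply_mem_map₂ (compBilin U V W) hx hy

theorem opMul_le {P : Submodule ℂ (V →L[ℂ] W)} {Q : Submodule ℂ (U →L[ℂ] V)}
    {R : Submodule ℂ (U →L[ℂ] W)} : opMul P Q ≤ R ↔ ∀ x ∈ P, ∀ y ∈ Q, x ∘L y ∈ R :=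
  Submodule.map₂_le

theorem opMul_mono {P P' : Submodule ℂ (V →L[ℂ] W)} {Q Q' : Submodule ℂ (U →L[ℂ] V)}
    (h : P ≤ P') (h' : Q ≤ Q') : opMul P Q ≤ opMul P' Q' :=
  Submodule.map₂_le_map₂ h h'

/-- With one outer factor fixed, membership of the product in a subspace is a linear condition on
the remaining factor, so it suffices to test that factor on products. -/
theorem opMul_assoc (P : Submodule ℂ (W →L[ℂ] T)) (Q : Submodule ℂ (V →L[ℂ] W))
    (R : Submodule ℂ (U →L[ℂ] V)) : opMul (opMul P Q) R = opMul P (opMul Q R) := by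
  refine le_antisymm (opMul_le.2 fun x hx r hr => ?_) (opMul_le.2 fun p hp x hx => ?_)
  · have h : opMul P Q ≤ (opMul P (opMul Q R)).comap ((compBilin U V T).flip r) :=
      opMul_le.2 fun p hp q hq => comp_mem_opMul hp (comp_mem_opMul hq hr)
    exact h hx
  · have h : opMul Q R ≤ (opMul (opMul P Q) R).comap (compBilin U W T p) :=
      opMul_le.2 fun q hq r hr => comp_mem_opMul (comp_mem_opMul hp hq) hr
    exact h hx

variable [CompleteSpace U] [CompleteSpace V] [CompleteSpace W]

/-- The adjoints of the operators in a subspace. -/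
def opAdj (P : Submodule ℂ (V →L[ℂ] W)) : Submodule ℂ (W →L[ℂ] V) where
  carrier := {x | ContinuousLinearMap.adjoint x ∈ P}
  zero_mem' := by simp
  add_mem' hx hy := by
    simp only [Set.mem_ofPred_eq, map_add] at *
    exact P.add_mem hx hy
  smul_mem' z x hx := by
    simp only [Set.mem_ofPred_eq, map_smulₛₗ] at *
    exact P.smul_mem _ hx

theorem mem_opAdj {P : Submodule ℂ (V →L[ℂ] W)} {x : W →L[ℂ] V} :
    x ∈ opAdj P ↔ ContinuousLinearMap.adjoint x ∈ P := Iff.rfl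

theorem adjoint_mem_opAdj {P : Submodule ℂ (V →L[ℂ] W)} {x : V →L[ℂ] W} (hx : x ∈ P) :
    ContinuousLinearMap.adjoint x ∈ opAdj P := by
  simpa [mem_opAdj] using hx

theorem opAdj_opMul (P : Submodule ℂ (V →L[ℂ] W)) (Q : Submodule ℂ (U →L[ℂ] V)) :
    opAdj (opMul P Q) = opMul (opAdj Q) (opAdj P) := by
  refine le_antisymm (fun x hx => ?_) (opMul_le.2 fun q hq p hp => ?_)
  · have h : opMul P Q ≤ opAdj (opMul (opAdj Q) (opAdj P)) := opMul_le.2 fun p hp q hq => by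
      rw [mem_opAdj, ContinuousLinearMap.adjoint_comp]
      exact comp_mem_opMul (adjoint_mem_opAdj hq) (adjoint_mem_opAdj hp)
    simpa [mem_opAdj] using h hx
  · rw [mem_opAdj, ContinuousLinearMap.adjoint_comp]
    exact comp_mem_opMul hp hq

end OperatorSpaces

/-! ### The represented algebra as a subspace of operators -/

namespace FinSpectralTriple

variable (X : FinSpectralTriple.{u})

/-- The subspace of the operators that represent elements of the algebra. -/
def algOps : Submodule ℂ (X.H →L[ℂ] X.H) := LinearMap.range X.π.toAlgHom.toLinearMap

variable {X}

theorem mem_algOps {x : X.H →L[ℂ] X.H} : x ∈ X.algOps ↔ ∃ a, X.π a = x := Iff.rfl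

theorem π_mem_algOps (a : X.A) : X.π a ∈ X.algOps := ⟨a, rfl⟩

theorem one_mem_algOps : ContinuousLinearMap.id ℂ X.H ∈ X.algOps := ⟨1, map_one X.π⟩

theorem π_star (a : X.A) : X.π (star a) = ContinuousLinearMap.adjoint (X.π a) := map_star X.π a

theorem π_mul (a b : X.A) : X.π (a * b) = X.π a ∘L X.π b := map_mul X.π a b

end FinSpectralTriple

/-! ### Operator bimodules -/

/-- A subspace of operators from `H` to `H'` that is an `A'`-`A` Morita equivalence bimodule for
the Hermitian structures `x* y` and `x y*`, and is compatible with the Dirac operators. -/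
structure OpBimodule (X Y : FinSpectralTriple.{u}) where
  carrier : Submodule ℂ (X.H →L[ℂ] Y.H)
  left_le : opMul Y.algOps carrier ≤ carrier
  right_le : opMul carrier X.algOps ≤ carrier
  adj_mul : opMul (opAdj carrier) carrier = X.algOps
  mul_adj : opMul carrier (opAdj carrier) = Y.algOps
  dirac : ∀ x ∈ carrier, Y.D ∘L x - x ∘L X.D ∈ opMul carrier X.Omega

namespace OpBimodule

variable {X Y Z : FinSpectralTriple.{u}}

/-- The algebra contains the identity operator. Together with `right_eq` this becomes the unit law
of the category. -/
theorem left_eq (B : OpBimodule X Y) : opMul Y.algOps B.carrier = B.carrier :=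
  le_antisymm B.left_le fun _ hx => comp_mem_opMul FinSpectralTriple.one_mem_algOps hx

theorem right_eq (B : OpBimodule X Y) : opMul B.carrier X.algOps = B.carrier :=
  le_antisymm B.right_le fun _ hx => comp_mem_opMul hx FinSpectralTriple.one_mem_algOps

theorem π_comp_mem (B : OpBimodule X Y) (b : Y.A) {x : X.H →L[ℂ] Y.H} (hx : x ∈ B.carrier) :
    Y.π b ∘L x ∈ B.carrier :=
  B.left_le (comp_mem_opMul (Y.π_mem_algOps b) hx)

theorem comp_π_mem (B : OpBimodule X Y) (a : X.A) {x : X.H →L[ℂ] Y.H} (hx : x ∈ B.carrier) :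
    x ∘L X.π a ∈ B.carrier :=
  B.right_le (comp_mem_opMul hx (X.π_mem_algOps a))

/-- The operator form of `σ`: `a[D', b]x = a(D'(bx) - (bx)D) - ab(D'x - xD)`, and both terms on the
right lie in `BΩ¹` by the Dirac condition for `bx` and for `x`. -/
theorem omega_mul_le (B : OpBimodule X Y) :
    opMul Y.Omega B.carrier ≤ opMul B.carrier X.Omega := by
  have hl : ∀ (a : Y.A) {y : X.H →L[ℂ] Y.H}, y ∈ opMul B.carrier X.Omega →
      Y.π a ∘L y ∈ opMul B.carrier X.Omega := fun a y hy => by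
    have h := comp_mem_opMul (Y.π_mem_algOps a) hy
    rwa [← opMul_assoc, B.left_eq] at h
  refine opMul_le.2 fun ω hω x hx => ?_
  have h : Y.Omega ≤ (opMul B.carrier X.Omega).comap ((compBilin X.H Y.H Y.H).flip x) := by
    refine Submodule.span_le.2 ?_
    rintro _ ⟨a, b, rfl⟩
    have h1 := hl a (B.dirac _ (B.π_comp_mem b hx))
    have h2 := hl a (hl b (B.dirac x hx))
    have h3 := Submodule.sub_mem _ h1 h2
    have e : Y.π a ∘L (Y.D ∘L (Y.π b ∘L x) - (Y.π b ∘L x) ∘L X.D)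
        - Y.π a ∘L (Y.π b ∘L (Y.D ∘L x - x ∘L X.D)) = (Y.π a * Y.commD b) ∘L x := by
      ext ψ
      simp [FinSpectralTriple.commD]
    rw [e] at h3
    exact h3
  exact h hω

/-- The product of two operator bimodules. -/
def mul (B' : OpBimodule Y Z) (B : OpBimodule X Y) : OpBimodule X Z where
  carrier := opMul B'.carrier B.carrier
  left_le := by rw [← opMul_assoc, B'.left_eq]
  right_le := by rw [opMul_assoc, B.right_eq]
  adj_mul := by
    -- `(B'B)*(B'B) = B*(B'*B')B = B*A'B = B*B = A`; the next field is the mirror image.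
    rw [opAdj_opMul, opMul_assoc, ← opMul_assoc (opAdj B'.carrier), B'.adj_mul, B.left_eq,
      B.adj_mul]
  mul_adj := by
    rw [opAdj_opMul, opMul_assoc, ← opMul_assoc B.carrier, B.mul_adj, ← opMul_assoc, B'.right_eq,
      B'.mul_adj]
  dirac x hx := by
    let δ : (X.H →L[ℂ] Z.H) →ₗ[ℂ] (X.H →L[ℂ] Z.H) :=
      compBilin X.H Z.H Z.H Z.D - (compBilin X.H X.H Z.H).flip X.D
    have h : opMul B'.carrier B.carrier
        ≤ (opMul (opMul B'.carrier B.carrier) X.Omega).comap δ := by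
      refine opMul_le.2 fun x' hx' x hx => ?_
      have h1 := comp_mem_opMul (B'.dirac x' hx') hx
      rw [opMul_assoc] at h1
      -- The term `(D''x' - x'D')x` lies in `B'Ω¹_{D'}B`; the middle one-forms are moved to the
      -- right of `B`.
      have h1' := opMul_mono le_rfl B.omega_mul_le h1
      have h2 := comp_mem_opMul hx' (B.dirac x hx)
      have h3 := Submodule.add_mem _ h1' h2
      rw [← opMul_assoc] at h3
      have e : (Z.D ∘L x' - x' ∘L Y.D) ∘L x + x' ∘L (Y.D ∘L x - x ∘L X.D) = δ (x' ∘L x) := by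
        ext ψ
        simp [δ]
      rw [e] at h3
      exact h3
    exact h hx

variable (X) in
/-- The operator bimodule of the algebra of a spectral triple. -/
def one : OpBimodule X X :=
  have hmul : opMul X.algOps X.algOps = X.algOps := by
    refine le_antisymm (opMul_le.2 ?_) fun x hx => comp_mem_opMul X.one_mem_algOps hx
    rintro _ ⟨a, rfl⟩ _ ⟨b, rfl⟩
    exact ⟨a * b, X.π_mul a b⟩
  have hadj : opAdj X.algOps = X.algOps := by
    ext x
    rw [mem_opAdj, FinSpectralTriple.mem_algOps, FinSpectralTriple.mem_algOps]
    constructor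
    · rintro ⟨a, ha⟩
      exact ⟨star a, by rw [X.π_star, ha, ContinuousLinearMap.adjoint_adjoint]⟩
    · rintro ⟨a, rfl⟩
      exact ⟨star a, X.π_star a⟩
  { carrier := X.algOps
    left_le := hmul.le
    right_le := hmul.le
    adj_mul := by rw [hadj, hmul]
    mul_adj := by rw [hadj, hmul]
    dirac := by
      rintro _ ⟨b, rfl⟩
      -- The commutator `[D, b]` is read as the identity operator times a one-form.
      refine comp_mem_opMul (y := X.commD b) X.one_mem_algOps ?_
      have h := (X.d b).2
      simpa only [FinSpectralTriple.d, FinSpectralTriple.form, map_one, one_mul] using h }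

end OpBimodule

/-! ### Lifting through injective maps, and elementary tensors -/

theorem BTensor.add_mk (A : Type*) [Ring A] {M N : Type*} [AddCommGroup M] [Module ℂ M]
    [Module Aᵐᵒᵖ M] [AddCommGroup N] [Module ℂ N] [Module A N] (m m' : M) (n : N) :
    mk A (m + m') n = mk A m n + mk A m' n := by
  simp [mk, TensorProduct.add_tmul]

theorem BTensor.smul_mk (A : Type*) [Ring A] {M N : Type*} [AddCommGroup M] [Module ℂ M]
    [Module Aᵐᵒᵖ M] [AddCommGroup N] [Module ℂ N] [Module A N] (z : ℂ) (m : M) (n : N) :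
    mk A (z • m) n = z • mk A m n := by
  simp [mk, ← TensorProduct.smul_tmul']

/-- This is how the connection, `σ` and the maps `x ↦ (id ⊗ σ)(x ⊗ η)` are built: each is known as
an operator-valued map, `m` embeds the balanced tensor product into operators, and only the range
has to be checked. -/
theorem LinearMap.exists_lift_of_injective {U V W : Type*} [AddCommGroup U] [Module ℂ U]
    [AddCommGroup V] [Module ℂ V] [AddCommGroup W] [Module ℂ W] (m : V →ₗ[ℂ] W)
    (hm : Function.Injective m) (L : U →ₗ[ℂ] W) (h : ∀ u, L u ∈ LinearMap.range m) :
    ∃ s : U →ₗ[ℂ] V, ∀ u, m (s u) = L u := by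
  refine ⟨(LinearEquiv.ofInjective m hm).symm.toLinearMap ∘ₗ L.codRestrict _ h, fun u => ?_⟩
  have e := (LinearEquiv.ofInjective m hm).apply_symm_apply (L.codRestrict _ h u)
  exact congrArg Subtype.val e

/-! ### Contractions with the Hermitian structure -/

namespace MoritaBimodule

variable {X Y : FinSpectralTriple.{u}} (M : MoritaBimodule X Y)
variable {N : Type*} [AddCommGroup N] [Module ℂ N] [Module X.A N] [IsScalarTower ℂ X.A N]

theorem innerR_op_smul (ξ η : M.E) (a : X.A) : M.innerR ξ (op a • η) = M.innerR ξ η * a := by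
  have h := M.innerR_smul ξ η 1 a
  simpa using h

/-- The contraction `η ⊗ n ↦ (ξ, η)_A n`. -/
def contract (ξ : M.E) : BTensor X.A M.E N →ₗ[ℂ] N :=
  BTensor.lift X.A (LinearMap.mk₂ ℂ (fun η n => M.innerR ξ η • n)
    (fun _ _ _ => by rw [map_add, add_smul]) (fun _ _ _ => by rw [map_smul, smul_assoc])
    (fun _ _ _ => smul_add _ _ _) (fun _ _ _ => smul_comm _ _ _))
    (fun η a n => by simp only [LinearMap.mk₂_apply, innerR_op_smul, mul_smul])

@[simp] theorem contract_mk (ξ η : M.E) (n : N) :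
    M.contract ξ (BTensor.mk X.A η n) = M.innerR ξ η • n :=
  BTensor.lift_mk X.A _ _ η n

/-- An element of `E ⊗_A N` whose contractions vanish is zero, by fullness. -/
theorem eq_zero_of_contract_eq_zero (x : BTensor X.A M.E N) (h : ∀ ξ, M.contract ξ x = 0) :
    x = 0 := by
  let act : Y.A →ₗ[ℂ] BTensor X.A M.E N →ₗ[ℂ] BTensor X.A M.E N :=
    { toFun := fun b => BTensor.map (DistribSMul.toLinearMap X.Aᵐᵒᵖ M.E b) LinearMap.id
      map_add' := fun b c => BTensor.hom_ext X.A fun η n => by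
        simp only [LinearMap.add_apply, BTensor.map_mk, DistribSMul.toLinearMap_apply, add_smul,
          BTensor.add_mk]
      map_smul' := fun z b => BTensor.hom_ext X.A fun η n => by
        simp only [LinearMap.smul_apply, BTensor.map_mk, DistribSMul.toLinearMap_apply,
          smul_assoc, BTensor.smul_mk, RingHom.id_apply] }
  have hact : ∀ b η n, act b (BTensor.mk X.A η n) = BTensor.mk X.A (b • η) n := fun b η n =>
    BTensor.map_mk _ _ η n
  have key : ∀ b : Y.A, act b x = 0 := by
    intro b
    -- The elements of `A'` that kill `x` form a subspace; by fullness it is everything once it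
    -- contains the values of the left Hermitian structure. The case `b = 1` then gives `x = 0`.
    have hb : b ∈ LinearMap.ker (act.flip x) := by
      have hle : (⊤ : Submodule ℂ Y.A) ≤ LinearMap.ker (act.flip x) := by
        rw [← M.fullL, Submodule.span_le]
        rintro _ ⟨η, ξ, rfl⟩
        let ins : N →ₗ[ℂ] BTensor X.A M.E N :=
          { toFun := fun n => BTensor.mk X.A η n
            map_add' := BTensor.mk_add X.A η
            map_smul' := fun z n => BTensor.mk_smul_right X.A z η n }
        -- `(η, ξ)_{A'} ζ ⊗ n = η (ξ, ζ)_A ⊗ n = η ⊗ (ξ, ζ)_A n`, so this action factors through the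
        -- contraction with `ξ`.
        have e : act (M.innerL η ξ) = ins ∘ₗ M.contract ξ := BTensor.hom_ext X.A fun ζ n => by
          rw [hact, ← M.compatible, BTensor.mk_smul]
          simp [ins]
        change act (M.innerL η ξ) x = 0
        rw [e, LinearMap.comp_apply, h, map_zero]
      exact hle trivial
    exact hb
  have h1 : act 1 = LinearMap.id := BTensor.hom_ext X.A fun η n => by
    rw [hact, one_smul]; rfl
  simpa [h1] using key 1

/-- Applied to `opForm`, `eval` and `prodOp`: there, contraction with `ξ` is recovered from `f` by
composing with the adjoint of the operator of `ξ`. -/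
theorem injective_of_contract {P : Type*} [AddCommGroup P] [Module ℂ P]
    (f : BTensor X.A M.E N →ₗ[ℂ] P)
    (h : ∀ x ξ, f x = 0 → M.contract ξ x = 0) : Function.Injective f :=
  (injective_iff_map_eq_zero f).2 fun x hx => M.eq_zero_of_contract_eq_zero x fun ξ => h x ξ hx

end MoritaBimodule

/-! ### Bimodules of operators as Morita equivalence bimodules -/

section OpForm

variable {X Y : FinSpectralTriple.{u}}
variable {E : Type u} [AddCommGroup E] [Module ℂ E] [Module X.Aᵐᵒᵖ E]

/-- The map `η ⊗ ω ↦ R(η) ω` from `E ⊗_A Ω¹_D(A)` to operators. -/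
def opForm (R : E →ₗ[ℂ] (X.H →L[ℂ] Y.H)) (hR : ∀ η a, R (op a • η) = R η ∘L X.π a) :
    BTensor X.A E X.Omega →ₗ[ℂ] (X.H →L[ℂ] Y.H) :=
  BTensor.lift X.A ((compBilin X.H X.H Y.H).compl₁₂ R X.Omega.subtype) (fun η a ω => by
    simp only [LinearMap.compl₁₂_apply, hR]
    rfl)

variable (R : E →ₗ[ℂ] (X.H →L[ℂ] Y.H)) (hR : ∀ η a, R (op a • η) = R η ∘L X.π a)

@[simp] theorem opForm_mk (η : E) (ω : X.Omega) :
    opForm R hR (BTensor.mk X.A η ω) = R η ∘L ω.1 :=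
  BTensor.lift_mk X.A _ _ η ω

theorem opForm_rmul [IsScalarTower ℂ X.Aᵐᵒᵖ E] (a : X.A) (x : BTensor X.A E X.Omega) :
    opForm R hR (rmul a x) = opForm R hR x ∘L X.π a := by
  have h : opForm R hR ∘ₗ rmul a = (compBilin X.H X.H Y.H).flip (X.π a) ∘ₗ opForm R hR :=
    BTensor.hom_ext X.A fun η ω => by
      simp only [LinearMap.comp_apply, rmul, BTensor.map_mk, opForm_mk, LinearMap.flip_apply,
        compBilin_apply, LinearMap.id_apply, DistribSMul.toLinearMap_apply,
        FinSpectralTriple.coe_op_smul_omega]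
      rfl
  exact LinearMap.congr_fun h x

/-- Together with injectivity this identifies `E ⊗_A Ω¹` with `BΩ¹`, so that the Dirac condition on
an operator bimodule is what a connection needs to exist. -/
theorem range_opForm : LinearMap.range (opForm R hR) = opMul (LinearMap.range R) X.Omega := by
  refine le_antisymm ?_ (opMul_le.2 ?_)
  · rintro _ ⟨x, rfl⟩
    -- Modulo the target subspace, the inclusion becomes the vanishing of a linear map, which can be
    -- tested on elementary tensors.
    have h : (opMul (LinearMap.range R) X.Omega).mkQ ∘ₗ opForm R hR = 0 :=
      BTensor.hom_ext X.A fun η ω => by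
        simpa using comp_mem_opMul (LinearMap.mem_range_self R η) ω.2
    simpa using LinearMap.congr_fun h x
  · rintro _ ⟨η, rfl⟩ ω hω
    exact ⟨BTensor.mk X.A η ⟨ω, hω⟩, opForm_mk R hR η ⟨ω, hω⟩⟩

end OpForm

theorem MoritaBimodule.opForm_injective {X Y : FinSpectralTriple.{u}} (M : MoritaBimodule X Y)
    (R : M.E →ₗ[ℂ] (X.H →L[ℂ] Y.H)) (hR : ∀ η a, R (op a • η) = R η ∘L X.π a)
    (hRR : ∀ η ξ, ContinuousLinearMap.adjoint (R η) ∘L R ξ = X.π (M.innerR η ξ)) :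
    Function.Injective (opForm R hR) := by
  refine M.injective_of_contract _ fun x ξ hx => Subtype.ext ?_
  have h : X.Omega.subtype ∘ₗ M.contract ξ
      = compBilin X.H Y.H X.H (ContinuousLinearMap.adjoint (R ξ)) ∘ₗ opForm R hR :=
    BTensor.hom_ext X.A fun η ω => by
      simp only [LinearMap.comp_apply, M.contract_mk, opForm_mk, compBilin_apply,
        ← ContinuousLinearMap.comp_assoc, hRR]
      rfl
  have h' := LinearMap.congr_fun h x
  simpa [hx] using h'

/-! ### The operators of a correspondence -/

namespace Correspondence

variable {X Y Z : FinSpectralTriple.{u}} (c : Correspondence X Y)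

/-- The operator `ψ ↦ U (η ⊗ ψ)`. -/
def toOp : c.E →ₗ[ℂ] (X.H →L[ℂ] Y.H) :=
  LinearMap.toContinuousLinearMap.toLinearMap ∘ₗ
    LinearMap.mk₂ ℂ (fun η ψ => c.U (BTensor.mk X.A η ψ))
      (fun η η' ψ => by rw [BTensor.add_mk, map_add])
      (fun z η ψ => by rw [BTensor.smul_mk, _root_.map_smul])
      (fun η ψ ψ' => by rw [BTensor.mk_add, map_add])
      (fun z η ψ => by rw [BTensor.mk_smul_right, _root_.map_smul])

@[simp] theorem toOp_apply (η : c.E) (ψ : X.H) : c.toOp η ψ = c.U (BTensor.mk X.A η ψ) := rfl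

theorem toOp_op_smul (η : c.E) (a : X.A) : c.toOp (op a • η) = c.toOp η ∘L X.π a := by
  ext ψ
  simp [BTensor.mk_smul, FinSpectralTriple.smul_def]

theorem toOp_smul (b : Y.A) (η : c.E) : c.toOp (b • η) = Y.π b ∘L c.toOp η := by
  ext ψ
  simp [c.map_smul]

/-- This is the isometry of `U`, read on elementary tensors. -/
theorem adjoint_toOp_comp (η ξ : c.E) :
    ContinuousLinearMap.adjoint (c.toOp η) ∘L c.toOp ξ = X.π (c.innerR η ξ) := by
  ext ψ
  refine ext_inner_left ℂ fun φ => ?_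
  rw [ContinuousLinearMap.comp_apply, ContinuousLinearMap.adjoint_inner_right]
  exact c.inner_map η ξ φ ψ

/-- As `U` is onto and elementary tensors span, the vectors `U(η ⊗ ψ)` span `H'`. -/
theorem ext_toOp {V : Type*} [NormedAddCommGroup V] [InnerProductSpace ℂ V] {f g : Y.H →L[ℂ] V}
    (h : ∀ η, f ∘L c.toOp η = g ∘L c.toOp η) : f = g := by
  have e : f.toLinearMap ∘ₗ c.U.toLinearMap = g.toLinearMap ∘ₗ c.U.toLinearMap :=
    BTensor.hom_ext X.A fun η ψ => DFunLike.congr_fun (h η) ψ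
  ext φ
  simpa using LinearMap.congr_fun e (c.U.symm φ)

/-- Composed with the operator of any `ζ`, the left side is the operator of `η (ξ, ζ)_A` and the
right side that of `(η, ξ)_{A'} ζ`; the compatibility of the two Hermitian structures equates them.
-/
theorem toOp_comp_adjoint (η ξ : c.E) :
    c.toOp η ∘L ContinuousLinearMap.adjoint (c.toOp ξ) = Y.π (c.innerL η ξ) := by
  refine c.ext_toOp fun ζ => ?_
  rw [ContinuousLinearMap.comp_assoc, adjoint_toOp_comp, ← toOp_op_smul, c.compatible, toOp_smul]

/-- If the operator of `η` vanishes, so does `π((η, η)_A)`, and faithfulness together with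
definiteness gives `η = 0`. -/
theorem toOp_injective : Function.Injective c.toOp := by
  refine (injective_iff_map_eq_zero _).2 fun η h => ?_
  by_contra hη
  refine (c.innerR_pos η hη).2 (X.π_injective ?_)
  rw [← adjoint_toOp_comp, h, map_zero, ContinuousLinearMap.comp_zero, map_zero]

/-- The map `η ⊗ ω ↦ U(η ⊗ ω ·)` from `E ⊗_A Ω¹_D(A)` to operators. -/
def form : BTensor X.A c.E X.Omega →ₗ[ℂ] (X.H →L[ℂ] Y.H) := opForm c.toOp c.toOp_op_smul

@[simp] theorem form_mk (η : c.E) (ω : X.Omega) :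
    c.form (BTensor.mk X.A η ω) = c.toOp η ∘L ω.1 :=
  opForm_mk _ _ η ω

theorem form_injective : Function.Injective c.form :=
  c.opForm_injective _ _ c.adjoint_toOp_comp

theorem form_rmul (a : X.A) (x : BTensor X.A c.E X.Omega) :
    c.form (rmul a x) = c.form x ∘L X.π a :=
  opForm_rmul _ _ a x

theorem form_lmul (b : Y.A) (x : BTensor X.A c.E X.Omega) :
    c.form (c.lmul b x) = Y.π b ∘L c.form x := by
  have h : c.form ∘ₗ c.lmul b = compBilin X.H Y.H Y.H (Y.π b) ∘ₗ c.form :=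
    BTensor.hom_ext X.A fun η ω => by
      simp [MoritaBimodule.lmul, toOp_smul, ContinuousLinearMap.comp_assoc]
  exact LinearMap.congr_fun h x

theorem form_apply (x : BTensor X.A c.E X.Omega) (ψ : X.H) :
    c.form x ψ = c.U (applyForm ψ x) := by
  have h : (LinearMap.applyₗ ψ ∘ₗ (ContinuousLinearMap.coeLM ℂ)) ∘ₗ c.form
      = c.U.toLinearMap ∘ₗ applyForm ψ :=
    BTensor.hom_ext X.A fun η ω => by simp
  exact LinearMap.congr_fun h x

/-- The intertwining relation of `U` with the Dirac operators, solved for `∇`. As `form` is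
injective, `∇` is determined by the other data, which is why similarity need not mention it. -/
theorem form_nabla (η : c.E) :
    c.form (c.nabla.toFun η) = Y.D ∘L c.toOp η - c.toOp η ∘L X.D := by
  ext ψ
  have h := c.map_dirac (BTensor.mk X.A η ψ)
  rw [fluctuatedDirac, BTensor.lift_mk, LinearMap.mk₂_apply, map_add, ← form_apply] at h
  simp [← h]

/-- The operator bimodule of a correspondence. -/
def toOpBimodule : OpBimodule X Y where
  carrier := LinearMap.range c.toOp
  left_le := by
    refine opMul_le.2 ?_
    rintro _ ⟨b, rfl⟩ _ ⟨η, rfl⟩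
    exact ⟨b • η, c.toOp_smul b η⟩
  right_le := by
    refine opMul_le.2 ?_
    rintro _ ⟨η, rfl⟩ _ ⟨a, rfl⟩
    exact ⟨op a • η, c.toOp_op_smul η a⟩
  adj_mul := by
    refine le_antisymm (opMul_le.2 ?_) ?_
    · rintro x ⟨η, hη⟩ _ ⟨ξ, rfl⟩
      have hx : x = ContinuousLinearMap.adjoint (c.toOp η) := by
        rw [hη, ContinuousLinearMap.adjoint_adjoint]
      rw [hx, adjoint_toOp_comp]
      exact X.π_mem_algOps _
    -- Fullness reduces this inclusion to the values of the Hermitian structure, which are products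
    -- `x* y`.
    · rw [FinSpectralTriple.algOps, LinearMap.range_eq_map, ← c.fullR, Submodule.map_span_le]
      rintro _ ⟨η, ξ, rfl⟩
      have h := comp_mem_opMul (adjoint_mem_opAdj (LinearMap.mem_range_self c.toOp η))
        (LinearMap.mem_range_self c.toOp ξ)
      rwa [adjoint_toOp_comp] at h
  mul_adj := by
    refine le_antisymm (opMul_le.2 ?_) ?_
    · rintro _ ⟨ξ, rfl⟩ x ⟨η, hη⟩
      have hx : x = ContinuousLinearMap.adjoint (c.toOp η) := by
        rw [hη, ContinuousLinearMap.adjoint_adjoint]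
      rw [hx, toOp_comp_adjoint]
      exact Y.π_mem_algOps _
    · rw [FinSpectralTriple.algOps, LinearMap.range_eq_map, ← c.fullL, Submodule.map_span_le]
      rintro _ ⟨η, ξ, rfl⟩
      have h := comp_mem_opMul (LinearMap.mem_range_self c.toOp η)
        (adjoint_mem_opAdj (LinearMap.mem_range_self c.toOp ξ))
      rwa [toOp_comp_adjoint] at h
  dirac := by
    rintro _ ⟨η, rfl⟩
    rw [← form_nabla, ← range_opForm c.toOp c.toOp_op_smul]
    exact LinearMap.mem_range_self _ _

end Correspondence

/-- A similarity `V` is a bijection with `c'.toOp ∘ V = c.toOp`. Conversely, equal ranges of the two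
injective maps give such a bijection, and it is right linear and unitary because both structures can
be read off from the operators. -/
theorem similar_iff_carrier_eq {X Y : FinSpectralTriple.{u}} {c c' : Correspondence X Y} :
    CorrSimilar c c' ↔ c.toOpBimodule.carrier = c'.toOpBimodule.carrier := by
  rw [similar_iff]
  constructor
  · rintro ⟨V, -, hV⟩
    have h : ∀ η, c'.toOp (V η) = c.toOp η := fun η => ContinuousLinearMap.ext (hV η)
    refine le_antisymm ?_ ?_
    · rintro _ ⟨η, rfl⟩
      exact ⟨V η, h η⟩
    · rintro _ ⟨η, rfl⟩
      exact ⟨V.symm η, by rw [← h, V.apply_symm_apply]⟩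
  · intro h
    let e : c.E ≃ₗ[ℂ] c'.E := (LinearEquiv.ofInjective c.toOp c.toOp_injective).trans
      ((LinearEquiv.ofEq _ _ h).trans (LinearEquiv.ofInjective c'.toOp c'.toOp_injective).symm)
    have he : ∀ η, c'.toOp (e η) = c.toOp η := fun η => by
      have h1 := (LinearEquiv.ofInjective c'.toOp c'.toOp_injective).apply_symm_apply
        (LinearEquiv.ofEq _ _ h (LinearEquiv.ofInjective c.toOp c.toOp_injective η))
      exact congrArg Subtype.val h1
    let V : c.E ≃ₗ[X.Aᵐᵒᵖ] c'.E :=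
      { e with
        map_smul' := fun a η => c'.toOp_injective <| by
          change c'.toOp (e (op a.unop • η)) = c'.toOp (op a.unop • e η)
          rw [he, c.toOp_op_smul, c'.toOp_op_smul, he] }
    refine ⟨V, fun η ξ => X.π_injective ?_, fun η ψ => DFunLike.congr_fun (he η) ψ⟩
    rw [← c.adjoint_toOp_comp, ← c'.adjoint_toOp_comp]
    change ContinuousLinearMap.adjoint (c'.toOp (e η)) ∘L c'.toOp (e ξ) = _
    rw [he, he]

/-! ### Realization of operator bimodules by correspondences -/

/-- The element of the algebra that is represented by a given operator. -/
def FinSpectralTriple.symbol (X : FinSpectralTriple.{u}) {x : X.H →L[ℂ] X.H}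
    (hx : x ∈ X.algOps) : X.A :=
  hx.choose

@[simp] theorem FinSpectralTriple.π_symbol (X : FinSpectralTriple.{u}) {x : X.H →L[ℂ] X.H}
    (hx : x ∈ X.algOps) : X.π (X.symbol hx) = x :=
  hx.choose_spec

/-- `‖a‖² - a a*` is positive because `‖a*ψ‖ ≤ ‖a‖ ‖ψ‖`; conjugation by `x` preserves positivity.
Both boundedness axioms of a Morita bimodule follow. -/
theorem FinSpectralTriple.isPositive_normSq_sub (X : FinSpectralTriple.{u}) {V : Type*}
    [NormedAddCommGroup V] [InnerProductSpace ℂ V] [CompleteSpace V] (x : X.H →L[ℂ] V) (a : X.A) :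
    (((‖X.π a‖ ^ 2 : ℝ) : ℂ) • (x ∘L ContinuousLinearMap.adjoint x)
      - (x ∘L X.π a) ∘L ContinuousLinearMap.adjoint (x ∘L X.π a)).IsPositive := by
  have h : (((‖X.π a‖ ^ 2 : ℝ) : ℂ) • ContinuousLinearMap.id ℂ X.H
      - X.π a ∘L ContinuousLinearMap.adjoint (X.π a)).IsPositive := by
    rw [ContinuousLinearMap.isPositive_iff_complex]
    intro ψ
    have e : ⟪(((‖X.π a‖ ^ 2 : ℝ) : ℂ) • ContinuousLinearMap.id ℂ X.H
        - X.π a ∘L ContinuousLinearMap.adjoint (X.π a)) ψ, ψ⟫_ℂ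
        = ((‖X.π a‖ ^ 2 * ‖ψ‖ ^ 2 - ‖ContinuousLinearMap.adjoint (X.π a) ψ‖ ^ 2 : ℝ) : ℂ) := by
      simp only [sub_apply, smul_apply,
        ContinuousLinearMap.comp_apply, ContinuousLinearMap.id_apply, inner_sub_left,
        inner_smul_left, Complex.conj_ofReal]
      rw [← ContinuousLinearMap.adjoint_inner_right, inner_self_eq_norm_sq_to_K,
        inner_self_eq_norm_sq_to_K]
      push_cast
      rfl
    rw [e]
    refine ⟨rfl, ?_⟩
    change 0 ≤ ‖X.π a‖ ^ 2 * ‖ψ‖ ^ 2 - ‖ContinuousLinearMap.adjoint (X.π a) ψ‖ ^ 2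
    have h1 := (ContinuousLinearMap.adjoint (X.π a)).le_opNorm ψ
    rw [LinearIsometryEquiv.norm_map] at h1
    have h2 := pow_le_pow_left₀ (norm_nonneg _) h1 2
    rw [mul_pow] at h2
    linarith
  have h' := h.conj_adjoint x
  convert h' using 1
  ext ψ
  simp [ContinuousLinearMap.adjoint_comp]

namespace OpBimodule

variable {X Y : FinSpectralTriple.{u}} (B : OpBimodule X Y)

/-- The left action on an operator bimodule. -/
instance leftModule : Module Y.A B.carrier where
  smul b x := ⟨Y.π b ∘L x.1, B.π_comp_mem b x.2⟩
  one_smul x := Subtype.ext (by change Y.π 1 ∘L x.1 = x.1; rw [map_one]; rfl)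
  mul_smul a b x := Subtype.ext (by
    change Y.π (a * b) ∘L x.1 = Y.π a ∘L Y.π b ∘L x.1; rw [Y.π_mul]; rfl)
  smul_zero b := Subtype.ext (ContinuousLinearMap.comp_zero _)
  smul_add b x y := Subtype.ext (ContinuousLinearMap.comp_add _ _ _)
  add_smul a b x := Subtype.ext (by
    change Y.π (a + b) ∘L x.1 = Y.π a ∘L x.1 + Y.π b ∘L x.1
    rw [map_add, ContinuousLinearMap.add_comp])
  zero_smul x := Subtype.ext (by
    change Y.π 0 ∘L x.1 = 0; rw [map_zero, ContinuousLinearMap.zero_comp])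

/-- The right action on an operator bimodule. -/
instance rightModule : Module X.Aᵐᵒᵖ B.carrier where
  smul a x := ⟨x.1 ∘L X.π a.unop, B.comp_π_mem a.unop x.2⟩
  one_smul x := Subtype.ext (by change x.1 ∘L X.π 1 = x.1; rw [map_one]; rfl)
  mul_smul a b x := Subtype.ext (by
    change x.1 ∘L X.π (b.unop * a.unop) = (x.1 ∘L X.π b.unop) ∘L X.π a.unop
    rw [X.π_mul]; rfl)
  smul_zero a := Subtype.ext (ContinuousLinearMap.zero_comp _)
  smul_add a x y := Subtype.ext (ContinuousLinearMap.add_comp _ _ _)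
  add_smul a b x := Subtype.ext (by
    change x.1 ∘L X.π (a.unop + b.unop) = x.1 ∘L X.π a.unop + x.1 ∘L X.π b.unop
    rw [map_add, ContinuousLinearMap.comp_add])
  zero_smul x := Subtype.ext (by
    change x.1 ∘L X.π 0 = 0; rw [map_zero, ContinuousLinearMap.comp_zero])

@[simp] theorem coe_smul (b : Y.A) (x : B.carrier) :
    ((b • x : B.carrier) : X.H →L[ℂ] Y.H) = Y.π b ∘L x.1 := rfl

@[simp] theorem coe_op_smul (a : X.A) (x : B.carrier) :
    ((op a • x : B.carrier) : X.H →L[ℂ] Y.H) = x.1 ∘L X.π a := rfl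

instance : IsScalarTower ℂ Y.A B.carrier where
  smul_assoc z b x := Subtype.ext (by
    change Y.π (z • b) ∘L x.1 = z • (Y.π b ∘L x.1)
    rw [map_smul, ContinuousLinearMap.smul_comp])

instance : IsScalarTower ℂ X.Aᵐᵒᵖ B.carrier where
  smul_assoc z a x := Subtype.ext (by
    change x.1 ∘L X.π (z • a.unop) = z • (x.1 ∘L X.π a.unop)
    rw [map_smul, ContinuousLinearMap.comp_smul])

instance : SMulCommClass Y.A X.Aᵐᵒᵖ B.carrier where
  smul_comm _ _ _ := rfl

theorem adjoint_comp_mem (x y : B.carrier) :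
    ContinuousLinearMap.adjoint x.1 ∘L y.1 ∈ X.algOps := by
  rw [← B.adj_mul]
  exact comp_mem_opMul (adjoint_mem_opAdj x.2) y.2

theorem comp_adjoint_mem (x y : B.carrier) :
    x.1 ∘L ContinuousLinearMap.adjoint y.1 ∈ Y.algOps := by
  rw [← B.mul_adj]
  exact comp_mem_opMul x.2 (adjoint_mem_opAdj y.2)

/-- The right Hermitian structure `x* y` of an operator bimodule. -/
def innerR : B.carrier →ₗ⋆[ℂ] B.carrier →ₗ[ℂ] X.A :=
  LinearMap.mk₂'ₛₗ (starRingEnd ℂ) (RingHom.id ℂ) (fun x y => X.symbol (B.adjoint_comp_mem x y))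
    (fun x x' y => X.π_injective (by
      simp [ContinuousLinearMap.add_comp]))
    (fun z x y => X.π_injective (by
      simp [map_smulₛₗ]))
    (fun x y y' => X.π_injective (by
      simp [ContinuousLinearMap.comp_add]))
    (fun z x y => X.π_injective (by simp))

/-- The left Hermitian structure `x y*` of an operator bimodule. -/
def innerL : B.carrier →ₗ[ℂ] B.carrier →ₗ⋆[ℂ] Y.A :=
  LinearMap.mk₂'ₛₗ (RingHom.id ℂ) (starRingEnd ℂ) (fun x y => Y.symbol (B.comp_adjoint_mem x y))
    (fun x x' y => Y.π_injective (by
      simp [ContinuousLinearMap.add_comp]))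
    (fun z x y => Y.π_injective (by simp))
    (fun x y y' => Y.π_injective (by
      simp [ContinuousLinearMap.comp_add]))
    (fun z x y => Y.π_injective (by
      simp [map_smulₛₗ]))

@[simp] theorem π_innerR (x y : B.carrier) :
    X.π (B.innerR x y) = ContinuousLinearMap.adjoint x.1 ∘L y.1 :=
  X.π_symbol (B.adjoint_comp_mem x y)

@[simp] theorem π_innerL (x y : B.carrier) :
    Y.π (B.innerL x y) = x.1 ∘L ContinuousLinearMap.adjoint y.1 :=
  Y.π_symbol (B.comp_adjoint_mem x y)

theorem span_innerR : Submodule.span ℂ {a : X.A | ∃ x y, a = B.innerR x y} = ⊤ := by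
  refine Submodule.map_injective_of_injective (f := X.π.toAlgHom.toLinearMap) X.π_injective ?_
  refine le_antisymm (Submodule.map_mono le_top) ?_
  rw [← LinearMap.range_eq_map]
  change X.algOps ≤ _
  rw [← B.adj_mul]
  refine opMul_le.2 fun x hx y hy => ?_
  -- Here `x` lies in the space of adjoints, so the first argument is the adjoint of `x`.
  refine ⟨B.innerR ⟨_, hx⟩ ⟨y, hy⟩, Submodule.subset_span ⟨_, _, rfl⟩, ?_⟩
  exact (B.π_innerR _ _).trans (by simp)

theorem span_innerL : Submodule.span ℂ {b : Y.A | ∃ x y, b = B.innerL x y} = ⊤ := by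
  refine Submodule.map_injective_of_injective (f := Y.π.toAlgHom.toLinearMap) Y.π_injective ?_
  refine le_antisymm (Submodule.map_mono le_top) ?_
  rw [← LinearMap.range_eq_map]
  change Y.algOps ≤ _
  rw [← B.mul_adj]
  refine opMul_le.2 fun x hx y hy => ?_
  refine ⟨B.innerL ⟨x, hx⟩ ⟨_, hy⟩, Submodule.subset_span ⟨_, _, rfl⟩, ?_⟩
  exact (B.π_innerL _ _).trans (by simp)

/-- The Morita equivalence bimodule of an operator bimodule. -/
@[reducible]
def toMoritaBimodule : MoritaBimodule X Y where
  E := B.carrier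
  innerR := B.innerR
  innerL := B.innerL
  innerR_smul x y a b := X.π_injective (by
    simp only [π_innerR, coe_op_smul, X.π_mul, X.π_star, ContinuousLinearMap.adjoint_comp]
    rfl)
  innerL_smul x y a b := Y.π_injective (by
    simp only [π_innerL, coe_smul, Y.π_mul, Y.π_star, ContinuousLinearMap.adjoint_comp]
    rfl)
  star_innerR x y := X.π_injective (by
    simp only [π_innerR, X.π_star, ContinuousLinearMap.adjoint_comp,
      ContinuousLinearMap.adjoint_adjoint])
  star_innerL x y := Y.π_injective (by
    simp only [π_innerL, Y.π_star, ContinuousLinearMap.adjoint_comp,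
      ContinuousLinearMap.adjoint_adjoint])
  innerR_pos x hx := by
    refine ⟨?_, fun h => hx (Subtype.ext ?_)⟩
    · rw [π_innerR]
      exact ContinuousLinearMap.isPositive_adjoint_comp_self x.1
    · have h1 := B.π_innerR x x
      rw [h, map_zero] at h1
      -- Definiteness is the C*-identity `‖x* x‖ = ‖x‖²`.
      have h2 := ContinuousLinearMap.norm_adjoint_comp_self x.1
      rw [← h1, norm_zero] at h2
      exact norm_eq_zero.1 (mul_self_eq_zero.1 h2.symm)
  innerL_pos x hx := by
    refine ⟨?_, fun h => hx (Subtype.ext ?_)⟩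
    · rw [π_innerL]
      exact ContinuousLinearMap.isPositive_self_comp_adjoint x.1
    · have h1 := B.π_innerL x x
      rw [h, map_zero] at h1
      have h2 := ContinuousLinearMap.norm_adjoint_comp_self (ContinuousLinearMap.adjoint x.1)
      rw [ContinuousLinearMap.adjoint_adjoint, ← h1, norm_zero] at h2
      exact (map_eq_zero_iff _ ContinuousLinearMap.adjoint.injective).1
        (norm_eq_zero.1 (mul_self_eq_zero.1 h2.symm))
  fullR := B.span_innerR
  fullL := B.span_innerL
  compatible x y z := Subtype.ext (by
    simp only [coe_smul, coe_op_smul, π_innerL, π_innerR]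
    rfl)
  bound_right a x := by
    rw [map_sub, map_smul, π_innerL, π_innerL, coe_op_smul]
    exact X.isPositive_normSq_sub x.1 a
  bound_left b x := by
    -- The left bound is the same estimate for `x*` and `b*`, as `(bx)*(bx) = (x*b*)(x*b*)*`.
    have h := Y.isPositive_normSq_sub (ContinuousLinearMap.adjoint x.1) (star b)
    rw [map_sub, map_smul, π_innerR, π_innerR, coe_smul]
    simpa only [Y.π_star, LinearIsometryEquiv.norm_map, ContinuousLinearMap.adjoint_adjoint,
      ContinuousLinearMap.adjoint_comp] using h

/-- Evaluation `x ⊗ ψ ↦ x ψ`. -/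
def eval : BTensor X.A B.carrier X.H →ₗ[ℂ] Y.H :=
  BTensor.lift X.A ((ContinuousLinearMap.coeLM ℂ : (X.H →L[ℂ] Y.H) →ₗ[ℂ] _) ∘ₗ B.carrier.subtype)
    (fun _ _ _ => rfl)

@[simp] theorem eval_mk (x : B.carrier) (ψ : X.H) : B.eval (BTensor.mk X.A x ψ) = x.1 ψ :=
  BTensor.lift_mk X.A _ _ x ψ

theorem eval_injective : Function.Injective B.eval := by
  refine B.toMoritaBimodule.injective_of_contract B.eval fun t y ht => ?_
  have h : B.toMoritaBimodule.contract y
      = (ContinuousLinearMap.adjoint (y : B.carrier).1).toLinearMap ∘ₗ B.eval :=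
    BTensor.hom_ext X.A fun x ψ => by
      refine (B.toMoritaBimodule.contract_mk y x ψ).trans ?_
      change X.π (B.innerR y x) ψ = ContinuousLinearMap.adjoint (y : B.carrier).1 (B.eval _)
      rw [π_innerR, eval_mk]
      rfl
  rw [h, LinearMap.comp_apply, ht, map_zero]

/-- `BB* = A'` contains the identity, so every `φ` is a sum of vectors `x(y φ)` with `x ∈ B` and `y
∈ B*`. -/
theorem eval_surjective : Function.Surjective B.eval := by
  intro φ
  have h : Y.algOps ≤ (LinearMap.range B.eval).comap
      (LinearMap.applyₗ φ ∘ₗ (ContinuousLinearMap.coeLM ℂ : (Y.H →L[ℂ] Y.H) →ₗ[ℂ] _)) := by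
    rw [← B.mul_adj]
    exact opMul_le.2 fun x hx y _ => ⟨BTensor.mk X.A ⟨x, hx⟩ (y φ), B.eval_mk _ _⟩
  exact h Y.one_mem_algOps

/-- `U` is evaluation, and `∇` is the lift of `x ↦ D'x - xD` through the embedding of `B ⊗_A Ω¹`
into operators. The axioms then become identities between operators. -/
theorem exists_correspondence : ∃ c : Correspondence X Y, c.toOpBimodule.carrier = B.carrier := by
  have hR : ∀ (x : B.carrier) (a : X.A),
      B.carrier.subtype (op a • x) = B.carrier.subtype x ∘L X.π a := fun _ _ => rfl
  have hm : Function.Injective (opForm B.carrier.subtype hR) :=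
    B.toMoritaBimodule.opForm_injective B.carrier.subtype hR
    fun x y => (B.π_innerR x y).symm
  obtain ⟨s, hs⟩ := LinearMap.exists_lift_of_injective (opForm B.carrier.subtype hR) hm
    ((compBilin X.H Y.H Y.H Y.D - (compBilin X.H X.H Y.H).flip X.D) ∘ₗ B.carrier.subtype)
    (fun x => by
      rw [range_opForm, Submodule.range_subtype]
      exact B.dirac x.1 x.2)
  have hs' : ∀ x, opForm B.carrier.subtype hR (s x) = Y.D ∘L x.1 - x.1 ∘L X.D := hs
  let nabla : Connection X B.carrier :=
    { toFun := s
      -- In operators: `D'xa - xaD = (D'x - xD)a + x[D, a]`.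
      leibniz := fun x a => hm (by
        rw [map_add, opForm_rmul, opForm_mk, hs', hs', coe_op_smul]
        ext ψ
        simp [FinSpectralTriple.d, FinSpectralTriple.form, FinSpectralTriple.commD]) }
  have happ : ∀ t ψ, B.eval (applyForm ψ t) = opForm B.carrier.subtype hR t ψ := by
    intro t ψ
    have h : B.eval ∘ₗ applyForm ψ
        = (LinearMap.applyₗ ψ ∘ₗ (ContinuousLinearMap.coeLM ℂ)) ∘ₗ opForm B.carrier.subtype hR :=
      BTensor.hom_ext X.A fun x ω => by simp
    exact LinearMap.congr_fun h t
  let U := LinearEquiv.ofBijective B.eval ⟨B.eval_injective, B.eval_surjective⟩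
  have hU : ∀ (x : B.carrier) ψ, U (BTensor.mk X.A x ψ) = x.1 ψ := B.eval_mk
  let c : Correspondence X Y :=
    { B.toMoritaBimodule with
      nabla := nabla
      U := U
      inner_map := fun x y ψ φ => by
        refine Eq.trans ?_ (congrArg (fun T : X.H →L[ℂ] X.H => ⟪ψ, T φ⟫_ℂ) (B.π_innerR x y).symm)
        refine (congrArg₂ (fun a b => ⟪a, b⟫_ℂ) (hU x ψ) (hU y φ)).trans ?_
        exact (ContinuousLinearMap.adjoint_inner_right _ _ _).symm
      map_smul := fun b x ψ =>
        (hU (b • x) ψ).trans (congrArg (Y.π b) (hU x ψ).symm)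
      map_dirac := fun t => by
        have h : B.eval ∘ₗ fluctuatedDirac nabla = Y.D.toLinearMap ∘ₗ B.eval :=
          BTensor.hom_ext X.A fun x ψ => by
            rw [LinearMap.comp_apply, fluctuatedDirac, BTensor.lift_mk, LinearMap.mk₂_apply,
              map_add, happ]
            change _ + opForm B.carrier.subtype hR (s x) ψ = _
            rw [hs']
            simp
        exact LinearMap.congr_fun h t }
  refine ⟨c, ?_⟩
  have hc : ∀ x : B.carrier, c.toOp x = x.1 := fun x => ContinuousLinearMap.ext (hU x)
  refine le_antisymm ?_ fun x hx => ⟨⟨x, hx⟩, hc _⟩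
  rintro _ ⟨x, rfl⟩
  exact (congrArg (· ∈ B.carrier) (hc x)).mpr (Subtype.property _)

end OpBimodule

/-! ### Identity and composition in terms of operator bimodules -/

section IdentityComposition

variable {X Y Z : FinSpectralTriple.{u}}

/-- Equality of ranges matches `E` with `A` through operators. Each clause of `IsIdentity` can then
be verified after applying one of the injective maps `toOp`, `form` and `π`, or directly on vectors
for the one about `U`. -/
theorem isIdentity_iff_carrier_eq {c : Correspondence X X} :
    IsIdentity c ↔ c.toOpBimodule.carrier = X.algOps := by
  constructor
  · rintro ⟨e, -, -, -, -, -, he⟩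
    have h : ∀ a, c.toOp (e a) = X.π a := fun a => ContinuousLinearMap.ext (he a)
    refine le_antisymm ?_ ?_
    · rintro _ ⟨η, rfl⟩
      exact ⟨e.symm η, by
        change X.π (e.symm η) = _
        rw [← h, e.apply_symm_apply]⟩
    · rintro _ ⟨a, rfl⟩
      exact ⟨e a, h a⟩
  · intro h
    let e : X.A ≃ₗ[ℂ] c.E := (LinearEquiv.ofInjective X.π.toAlgHom.toLinearMap X.π_injective).trans
      ((LinearEquiv.ofEq _ _ h.symm).trans (LinearEquiv.ofInjective c.toOp c.toOp_injective).symm)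
    have he : ∀ a, c.toOp (e a) = X.π a := fun a => by
      have h1 := (LinearEquiv.ofInjective c.toOp c.toOp_injective).apply_symm_apply
        (LinearEquiv.ofEq _ _ h.symm
          (LinearEquiv.ofInjective X.π.toAlgHom.toLinearMap X.π_injective a))
      exact congrArg Subtype.val h1
    refine ⟨e, fun a b => c.toOp_injective ?_, fun a b => c.toOp_injective ?_,
      fun a b => X.π_injective ?_, fun a b => X.π_injective ?_,
      fun a => c.form_injective ?_, fun a ψ => DFunLike.congr_fun (he a) ψ⟩
    · rw [c.toOp_smul, he, he, X.π_mul]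
    · rw [c.toOp_op_smul, he, he, X.π_mul]
    · rw [← c.adjoint_toOp_comp, he, he, X.π_mul, X.π_star]
    · rw [← c.toOp_comp_adjoint, he, he, X.π_mul, X.π_star]
    · rw [c.form_nabla, c.form_mk, he, he]
      ext ψ
      simp [FinSpectralTriple.d, FinSpectralTriple.form, FinSpectralTriple.commD]

theorem exists_isIdentity (X : FinSpectralTriple.{u}) : ∃ c : Correspondence X X, IsIdentity c :=
  (OpBimodule.one X).exists_correspondence.imp fun _ h => isIdentity_iff_carrier_eq.2 h

/-! ### Products of operators of two correspondences, and the map `σ` -/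

namespace Correspondence

variable (c : Correspondence X Y) (c' : Correspondence Y Z)

/-- The map `η' ⊗ η ↦ U' (η' ⊗ U (η ⊗ ·))` from `E' ⊗_{A'} E` to operators. -/
def prodOp : BTensor Y.A c'.E c.E →ₗ[ℂ] (X.H →L[ℂ] Z.H) :=
  BTensor.lift Y.A ((compBilin X.H Y.H Z.H).compl₁₂ c'.toOp c.toOp) (fun η' a η => by
    simp only [LinearMap.compl₁₂_apply, toOp_op_smul, toOp_smul]
    rfl)

@[simp] theorem prodOp_mk (η' : c'.E) (η : c.E) :
    prodOp c c' (BTensor.mk Y.A η' η) = c'.toOp η' ∘L c.toOp η :=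
  BTensor.lift_mk Y.A _ _ η' η

theorem prodOp_injective : Function.Injective (prodOp c c') := by
  refine c'.injective_of_contract _ fun x ξ hx => c.toOp_injective ?_
  have h : c.toOp ∘ₗ c'.contract ξ
      = compBilin X.H Z.H Y.H (ContinuousLinearMap.adjoint (c'.toOp ξ)) ∘ₗ prodOp c c' :=
    BTensor.hom_ext Y.A fun η' η => by
      simp only [LinearMap.comp_apply, MoritaBimodule.contract_mk, prodOp_mk, compBilin_apply,
        ← ContinuousLinearMap.comp_assoc, adjoint_toOp_comp, toOp_smul]
  have h' := LinearMap.congr_fun h x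
  rw [map_zero]
  simpa only [LinearMap.comp_apply, hx, map_zero] using h'

theorem range_prodOp :
    LinearMap.range (prodOp c c') = opMul (LinearMap.range c'.toOp) (LinearMap.range c.toOp) := by
  refine le_antisymm ?_ (opMul_le.2 ?_)
  · rintro _ ⟨x, rfl⟩
    have h : (opMul (LinearMap.range c'.toOp) (LinearMap.range c.toOp)).mkQ ∘ₗ prodOp c c' = 0 :=
      BTensor.hom_ext Y.A fun η' η => by
        simpa using comp_mem_opMul (LinearMap.mem_range_self c'.toOp η')
          (LinearMap.mem_range_self c.toOp η)
    simpa using LinearMap.congr_fun h x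
  · rintro _ ⟨η', rfl⟩ _ ⟨η, rfl⟩
    exact ⟨BTensor.mk Y.A η' η, prodOp_mk c c' η' η⟩

-- As operators, `σ` is just composition, `ω ⊗ η ↦ ω ∘ U(η ⊗ ·)`, so it does not depend on how `ω`
-- is written as a sum of `a'[D', b']`. By `omega_mul_le` its values lie in the range of the
-- injective map `form`.
set_option synthInstance.maxHeartbeats 200000 in
theorem exists_isSigma : ∃ σ : BTensor Y.A Y.Omega c.E →ₗ[ℂ] BTensor X.A c.E X.Omega,
    IsSigma c σ ∧ ∀ ω η, c.form (σ (BTensor.mk Y.A ω η)) = ω.1 ∘L c.toOp η := by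
  let L : BTensor Y.A Y.Omega c.E →ₗ[ℂ] (X.H →L[ℂ] Y.H) :=
    BTensor.lift Y.A ((compBilin X.H Y.H Y.H).compl₁₂ Y.Omega.subtype c.toOp) (fun ω a η => by
      simp only [LinearMap.compl₁₂_apply, toOp_smul]
      rfl)
  have hL : ∀ ω η, L (BTensor.mk Y.A ω η) = ω.1 ∘L c.toOp η := fun ω η =>
    BTensor.lift_mk Y.A _ _ ω η
  have hmem : ∀ x, L x ∈ LinearMap.range c.form := by
    intro x
    have h : (LinearMap.range c.form).mkQ ∘ₗ L = 0 := BTensor.hom_ext Y.A fun ω η => by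
      have h1 := c.toOpBimodule.omega_mul_le
        (comp_mem_opMul ω.2 (LinearMap.mem_range_self c.toOp η))
      rw [← hL] at h1
      rw [LinearMap.comp_apply, LinearMap.zero_apply, Submodule.mkQ_apply,
        Submodule.Quotient.mk_eq_zero, form, range_opForm]
      exact h1
    simpa only [LinearMap.comp_apply, LinearMap.zero_apply, Submodule.mkQ_apply,
        Submodule.Quotient.mk_eq_zero] using LinearMap.congr_fun h x
  obtain ⟨σ, hσ⟩ := LinearMap.exists_lift_of_injective c.form c.form_injective L hmem
  have h : ∀ ω η, c.form (σ (BTensor.mk Y.A ω η)) = ω.1 ∘L c.toOp η := fun ω η =>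
    (hσ _).trans (hL ω η)
  refine ⟨σ, ⟨fun a b η => c.form_injective ?_, fun a ω η => c.form_injective ?_,
    fun a ω η => c.form_injective ?_⟩, h⟩
  · rw [h, map_sub, form_lmul, form_lmul, form_nabla, form_nabla, toOp_smul]
    ext ψ
    simp [FinSpectralTriple.form, FinSpectralTriple.commD]
  · rw [h, form_lmul, h]
    rfl
  · rw [h, form_rmul, h, toOp_op_smul]
    rfl

end Correspondence

/-- The condition on `U''` says that `T` followed by `c''.toOp` is `prodOp`, which fixes the range.
Conversely, equal ranges define `T`, and the Hermitian structures, `σ` and the connection are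
compared as operators. -/
theorem isComposition_iff_carrier_eq {c : Correspondence X Y} {c' : Correspondence Y Z}
    {c'' : Correspondence X Z} : IsComposition c c' c'' ↔
      c''.toOpBimodule.carrier = opMul c'.toOpBimodule.carrier c.toOpBimodule.carrier := by
  change _ ↔ LinearMap.range c''.toOp = opMul (LinearMap.range c'.toOp) (LinearMap.range c.toOp)
  rw [← Correspondence.range_prodOp]
  constructor
  · rintro ⟨T, -, hT⟩
    have h : c''.toOp ∘ₗ T.t.toLinearMap = c.prodOp c' := BTensor.hom_ext Y.A fun η' η => by
      rw [Correspondence.prodOp_mk]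
      exact ContinuousLinearMap.ext (hT η' η)
    rw [← h, LinearEquiv.range_comp]
  · intro h
    let t : BTensor Y.A c'.E c.E ≃ₗ[ℂ] c''.E :=
      (LinearEquiv.ofInjective (c.prodOp c') (c.prodOp_injective c')).trans
        ((LinearEquiv.ofEq _ _ h.symm).trans
          (LinearEquiv.ofInjective c''.toOp c''.toOp_injective).symm)
    have ht : ∀ η' η, c''.toOp (t (BTensor.mk Y.A η' η)) = c'.toOp η' ∘L c.toOp η := by
      intro η' η
      have h1 := (LinearEquiv.ofInjective c''.toOp c''.toOp_injective).apply_symm_apply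
        (LinearEquiv.ofEq _ _ h.symm (LinearEquiv.ofInjective (c.prodOp c')
          (c.prodOp_injective c') (BTensor.mk Y.A η' η)))
      exact (congrArg Subtype.val h1).trans (c.prodOp_mk c' η' η)
    let T : TensorIso c.toMoritaBimodule c'.toMoritaBimodule c''.toMoritaBimodule :=
      { t := t
        map_left := fun b η' η => c''.toOp_injective (by
          rw [c''.toOp_smul, ht, ht, c'.toOp_smul]; rfl)
        map_right := fun a η' η => c''.toOp_injective (by
          rw [c''.toOp_op_smul, ht, ht, c.toOp_op_smul]; rfl)
        map_innerR := fun η₁' η₂' η₁ η₂ => X.π_injective (by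
          rw [← c''.adjoint_toOp_comp, ht, ht, ← c.adjoint_toOp_comp, c.toOp_smul,
            ← c'.adjoint_toOp_comp, ContinuousLinearMap.adjoint_comp]
          rfl)
        map_innerL := fun η₁' η₂' η₁ η₂ => Z.π_injective (by
          rw [← c''.toOp_comp_adjoint, ht, ht, ← c'.toOp_comp_adjoint, c'.toOp_op_smul,
            ← c.toOp_comp_adjoint, ContinuousLinearMap.adjoint_comp]
          rfl) }
    have hins : ∀ (η' : c'.E) x, c''.form (T.insertForm η' x) = c'.toOp η' ∘L c.form x := by
      intro η' x
      have e : c''.form ∘ₗ T.insertForm η' = compBilin X.H Y.H Z.H (c'.toOp η') ∘ₗ c.form :=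
        BTensor.hom_ext X.A fun η ω => by
          rw [LinearMap.comp_apply, TensorIso.insertForm, BTensor.map_mk, c''.form_mk]
          change c''.toOp (t (BTensor.mk Y.A η' η)) ∘L ω.1 = _
          rw [ht, LinearMap.comp_apply, c.form_mk]
          rfl
      exact LinearMap.congr_fun e x
    obtain ⟨σ, hσ, hσ'⟩ := c.exists_isSigma
    -- `x ↦ (id ⊗ σ)(x ⊗ η)` is right composition with the operator of `η`; on elementary tensors,
    -- `σ` supplies the preimage.
    have hS : ∀ η : c.E, ∃ S : BTensor Y.A c'.E Y.Omega →ₗ[ℂ] BTensor X.A c''.E X.Omega,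
        ∀ x, c''.form (S x) = c'.form x ∘L c.toOp η := by
      intro η
      refine LinearMap.exists_lift_of_injective c''.form c''.form_injective
        ((compBilin X.H Y.H Z.H).flip (c.toOp η) ∘ₗ c'.form) fun x => ?_
      have e : (LinearMap.range c''.form).mkQ
          ∘ₗ ((compBilin X.H Y.H Z.H).flip (c.toOp η) ∘ₗ c'.form) = 0 :=
        BTensor.hom_ext Y.A fun η' ω => by
          rw [LinearMap.comp_apply, LinearMap.zero_apply, Submodule.mkQ_apply,
            Submodule.Quotient.mk_eq_zero, LinearMap.comp_apply, c'.form_mk]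
          refine ⟨T.insertForm η' (σ (BTensor.mk Y.A ω η)), ?_⟩
          rw [hins, hσ']
          rfl
      simpa only [LinearMap.comp_apply, LinearMap.zero_apply, Submodule.mkQ_apply,
        Submodule.Quotient.mk_eq_zero] using LinearMap.congr_fun e x
    choose S hS using hS
    refine ⟨T, ⟨σ, hσ, S, fun η η' ω => c''.form_injective ?_, fun η' η => c''.form_injective ?_⟩,
      fun η' η ψ => DFunLike.congr_fun (ht η' η) ψ⟩
    · rw [hS, hins, hσ', c'.form_mk]
      rfl
    -- The formula for `∇''` is `D''x'x - x'xD = (D''x' - x'D')x + x'(D'x - xD)`.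
    · rw [map_add, hS, hins, c''.form_nabla, c'.form_nabla, c.form_nabla]
      change Z.D ∘L c''.toOp (t (BTensor.mk Y.A η' η))
        - c''.toOp (t (BTensor.mk Y.A η' η)) ∘L X.D = _
      rw [ht]
      ext ψ
      simp

theorem exists_isComposition (c : Correspondence X Y) (c' : Correspondence Y Z) :
    ∃ c'' : Correspondence X Z, IsComposition c c' c'' :=
  (c'.toOpBimodule.mul c.toOpBimodule).exists_correspondence.imp fun _ h =>
    isComposition_iff_carrier_eq.2 h

end IdentityComposition

/-! ### The category of M-morphisms -/

namespace MMorphism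

variable {W X Y Z : FinSpectralTriple.{u}}

/-- A correspondence in a similarity class. -/
def rep (f : MMorphism X Y) : Correspondence X Y := Quotient.out f

theorem toMMorphism_rep (f : MMorphism X Y) : f.rep.toMMorphism = f := Quotient.out_eq f

/-- The operator bimodule of an M-morphism. -/
def bimod (f : MMorphism X Y) : OpBimodule X Y := f.rep.toOpBimodule

/-- The chosen representative is similar to `c`, and similar correspondences have the same range. -/
theorem bimod_toMMorphism (c : Correspondence X Y) :
    c.toMMorphism.bimod.carrier = c.toOpBimodule.carrier :=
  similar_iff_carrier_eq.1 (Quotient.exact (toMMorphism_rep c.toMMorphism))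

/-- The range is a complete invariant of an M-morphism, so equations between M-morphisms become
equations between subspaces of operators. -/
theorem ext_carrier {f g : MMorphism X Y} (h : f.bimod.carrier = g.bimod.carrier) : f = g := by
  rw [← toMMorphism_rep f, ← toMMorphism_rep g]
  exact Quotient.sound (similar_iff_carrier_eq.2 h)

variable (X) in
/-- The identity M-morphism. -/
def ident : MMorphism X X := (exists_isIdentity X).choose.toMMorphism

/-- The composition of M-morphisms. -/
def comp (f : MMorphism X Y) (g : MMorphism Y Z) : MMorphism X Z :=
  (exists_isComposition f.rep g.rep).choose.toMMorphism

theorem carrier_ident : (ident X).bimod.carrier = X.algOps :=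
  (bimod_toMMorphism _).trans (isIdentity_iff_carrier_eq.1 (exists_isIdentity X).choose_spec)

theorem carrier_comp (f : MMorphism X Y) (g : MMorphism Y Z) :
    (f.comp g).bimod.carrier = opMul g.bimod.carrier f.bimod.carrier :=
  (bimod_toMMorphism _).trans
    (isComposition_iff_carrier_eq.1 (exists_isComposition f.rep g.rep).choose_spec)

theorem comp_assoc (f : MMorphism W X) (g : MMorphism X Y) (h : MMorphism Y Z) :
    (f.comp g).comp h = f.comp (g.comp h) :=
  ext_carrier (by simp only [carrier_comp, opMul_assoc])

theorem ident_comp (f : MMorphism X Y) : (ident X).comp f = f :=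
  ext_carrier (by rw [carrier_comp, carrier_ident, f.bimod.right_eq])

theorem comp_ident (f : MMorphism X Y) : f.comp (ident Y) = f :=
  ext_carrier (by rw [carrier_comp, carrier_ident, f.bimod.left_eq])

end MMorphism
end

/-! ### The Morita category -/

theorem mainTheorem1 :
    -- every spectral triple has an identity correspondence, and correspondences can be composed
    (∀ X : FinSpectralTriple.{u}, ∃ c : Correspondence X X, IsIdentity c) ∧
    (∀ (X Y Z : FinSpectralTriple.{u}) (c : Correspondence X Y) (c' : Correspondence Y Z),
      ∃ c'' : Correspondence X Z, IsComposition c c' c'') ∧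
    -- both are well defined on M-morphisms
    ∃ (ident : ∀ X : FinSpectralTriple.{u}, MMorphism X X)
      (comp : ∀ {X Y Z : FinSpectralTriple.{u}}, MMorphism X Y → MMorphism Y Z → MMorphism X Z),
      (∀ (X : FinSpectralTriple.{u}) (c : Correspondence X X),
        IsIdentity c → ident X = c.toMMorphism) ∧
      (∀ (X Y Z : FinSpectralTriple.{u}) (c : Correspondence X Y) (c' : Correspondence Y Z)
        (c'' : Correspondence X Z), IsComposition c c' c'' →
          comp c.toMMorphism c'.toMMorphism = c''.toMMorphism) ∧
      -- composition is associative
      (∀ (W X Y Z : FinSpectralTriple.{u}) (f : MMorphism W X) (g : MMorphism X Y)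
        (h : MMorphism Y Z), comp (comp f g) h = comp f (comp g h)) ∧
      -- spectral triples and M-morphisms form a category
      ∃ C : CategoryTheory.Category.{u + 1} FinSpectralTriple.{u},
        C.toCategoryStruct = { Hom := MMorphism, id := ident, comp := comp } := by
  refine ⟨exists_isIdentity, fun X Y Z c c' => exists_isComposition c c',
    MMorphism.ident, MMorphism.comp, fun X c hc => MMorphism.ext_carrier ?_,
    fun X Y Z c c' c'' hc => MMorphism.ext_carrier ?_,
    fun W X Y Z f g h => MMorphism.comp_assoc f g h,
    { Hom := MMorphism
      id := MMorphism.ident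
      comp := MMorphism.comp
      id_comp := MMorphism.ident_comp
      comp_id := MMorphism.comp_ident
      assoc := MMorphism.comp_assoc }, rfl⟩
  · rw [MMorphism.carrier_ident, MMorphism.bimod_toMMorphism, isIdentity_iff_carrier_eq.1 hc]
  -- Any composition of any representatives has the product of the two ranges as its range, so the
  -- choices made in `comp` do not matter.
  · simp only [MMorphism.carrier_comp, MMorphism.bimod_toMMorphism]
    exact (isComposition_iff_carrier_eq.1 hc).symm
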